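/- **Theorem (Equivalent Objective for Distribution Matching).** *Setting.* Let $A$ be a finite vocabulary and let $S$ be the set of finite token sequences (contexts) over $A$. Consider the token-level MDP with states $S$, actions $A$, an initial (prompt) distribution on $S$, a set of terminal contexts, a discount factor $\gamma\in[0,1)$, and deterministic transitions $s'=s\oplus a$ (the token $a$ is appended to $s$), terminal contexts being absorbing. A policy $\pi$ assigns to each $s\in S$ a probability distribution $\pi(\cdot\mid s)$ on $A$. Put $$\rho_\pi(s)=(1-\gamma)\sum_{i\ge 0}\gamma^i P(s_i=s\mid\pi),\qquad \mu_\pi(s,a)=\pi(a\mid s)\,\rho_\pi(s),$$ and, for a reference policy $\pi_{\mathrm{ref}}$, $$D_{\mathrm{KL}}(\pi\|\pi_{\mathrm{ref}})=\sum_{s}\rho_\pi(s)\,D_{\mathrm{KL}}\big(\pi(\cdot\mid s)\,\|\,\pi_{\mathrm{ref}}(\cdot\mid s)\big)\in[0,\infty].$$ Let $\beta>0$, let $\pi_E$ be an expert policy and $\mu_E=\mu_{\pi_E}$. Let $f:(0,\infty)\to\mathbb R$ be convex with $f(1)=0$, and let $$D_f(P\|Q)=\sum_{x}Q(x)\,f\!\left(\frac{P(x)}{Q(x)}\right),\qquad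 f^*(y)=\sup_{t>0}\,\big(ty-f(t)\big)\in(-\infty,\infty],$$ with the usual conventions $f(0)=\lim_{t\downarrow0}f(t)$, $0\cdot f(p/0)=p\lim_{t\to\infty}f(t)/t$ and $0\cdot f(0/0)=0$. For a reward $r:S\times A\to\mathbb R$ write $$J_r(\pi)=\mathbb E_{\mu_\pi}[r]-\beta D_{\mathrm{KL}}(\pi\|\pi_{\mathrm{ref}}),\qquad L(r)=\mathbb E_{\mu_E}[f^*(-r)]+\sup_\pi J_r(\pi).$$ Let $\mathcal R$ be any class of rewards $r$ such that $f^*(-r(s,a))<\infty$ for all $(s,a)$ and $\mathbb E_{\mu_\pi}|r|<\infty$ for every policy $\pi$, and such that $\mathcal R$ contains every bounded $r$ with $f^*(-r)<\infty$ everywhere (for instance, the class of exactly these bounded rewards). *Claim.* As an identity in $[-\infty,\infty]$, $$\min_\pi\Big[D_f(\mu_\pi\|\mu_E)+\beta D_{\mathrm{KL}}(\pi\|\pi_{\mathrm{ref}})\Big]\;=\;-\inf_{r\in\mathcal R}\Big[\mathbb E_{\mu_E}[f^*(-r)]+\sup_\pi\big(\mathbb E_{\mu_\pi}[r]-\beta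 D_{\mathrm{KL}}(\pi\|\pi_{\mathrm{ref}})\big)\Big].$$ The minimum on the left is attained, and for every bounded reward $r$ the supremum over $\pi$ of $J_r(\pi)$ is attained. Moreover, if $r^*\in\mathcal R$ attains the infimum on the right, then a policy minimizes $D_f(\mu_\pi\|\mu_E)+\beta D_{\mathrm{KL}}(\pi\|\pi_{\mathrm{ref}})$ if and only if it maximizes $J_{r^*}$. -/

import Mathlib

open Set Filter Topology
open scoped ENNReal

noncomputable section

namespace TokenLevel

/-- The token-level Markov decision process over a vocabulary `A`. States are contexts, that is
finite sequences of tokens; actions are tokens. `init` is the law of the initial context (the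
prompt), `terminal` is the set of terminal contexts and `γ` is the discount factor. -/
structure TokenMDP (A : Type*) where
  init : PMF (List A)
  terminal : Set (List A)
  γ : ℝ
  γ_nonneg : 0 ≤ γ
  γ_lt_one : γ < 1

/-- A (stationary, randomized) policy: a next-token distribution for every context. -/
abbrev Policy (A : Type*) := List A → PMF A

namespace TokenMDP

variable {A : Type*} (M : TokenMDP A)

open Classical in
/-- The deterministic transition: the chosen token is appended to the context. Terminal contexts
are absorbing. -/
def next (s : List A) (a : A) : List A := if s ∈ M.terminal then s else s ++ [a]

/-- The law of the state `s_i` at time `i` under the policy `π`. -/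
def stateLaw (π : Policy A) : ℕ → PMF (List A)
  | 0 => M.init
  | i + 1 => (stateLaw π i).bind fun s => (π s).map (M.next s)

/-- The occupancy measure `ρ_π(s) = (1 - γ) ∑ i, γ ^ i * P(s_i = s | π)`. -/
def occupancy (π : Policy A) (s : List A) : ℝ :=
  (1 - M.γ) * ∑' i : ℕ, M.γ ^ i * (M.stateLaw π i s).toReal

/-- The state-action distribution `μ_π(s, a) = π(a | s) * ρ_π(s)`. -/
def stateAction (π : Policy A) (x : List A × A) : ℝ :=
  (π x.1 x.2).toReal * M.occupancy π x.1

/-- The Kullback-Leibler divergence of two next-token distributions. -/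
def tokenKL (p q : PMF A) : ℝ≥0∞ :=
  letI : MeasurableSpace A := ⊤
  InformationTheory.klDiv p.toMeasure q.toMeasure

/-- The Kullback-Leibler regularizer `D_KL(π ‖ π_ref) = E_{s ∼ ρ_π} D_KL(π(· | s) ‖ π_ref(· | s))`,
which is the expectation of `log (π(a | s) / π_ref(a | s))` under `μ_π`. -/
def policyKL (π πref : Policy A) : ℝ≥0∞ :=
  ∑' s : List A, ENNReal.ofReal (M.occupancy π s) * tokenKL (π s) (πref s)

end TokenMDP

/-- The sum of an extended-real family as a Lebesgue integral for counting measure: the sum of the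
positive parts minus the sum of the negative parts. -/
def esum {ι : Type*} (g : ι → EReal) : EReal :=
  ((∑' i, (g i).toENNReal : ℝ≥0∞) : EReal) - ((∑' i, (-(g i)).toENNReal : ℝ≥0∞) : EReal)

/-- A generator of an `f`-divergence: a convex function on `(0, ∞)` vanishing at `1`. The values
of `f` outside `(0, ∞)` are never used. -/
structure IsDivergenceGenerator (f : ℝ → ℝ) : Prop where
  convexOn : ConvexOn ℝ (Ioi 0) f
  map_one : f 1 = 0

/-- `f(0) = lim_{t → 0+} f(t)`, an element of `(-∞, ∞]` for convex `f`
(the limit exists, so that it is the upper limit). -/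
def valueAtZero (f : ℝ → ℝ) : EReal := limsup (fun t : ℝ => (f t : EReal)) (𝓝[>] 0)

/-- `f'(∞) = lim_{t → ∞} f(t) / t`, an element of `(-∞, ∞]` for convex `f`
(the limit exists, so that it is the upper limit). -/
def slopeAtTop (f : ℝ → ℝ) : EReal := limsup (fun t : ℝ => ((f t / t : ℝ) : EReal)) atTop

/-- The summand `q * f(p / q)` of an `f`-divergence, with the usual conventions
`q * f(0 / q) = q * f(0)`, `0 * f(p / 0) = p * f'(∞)` and `0 * f(0 / 0) = 0`. -/
def fDivTerm (f : ℝ → ℝ) (p q : ℝ) : EReal :=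
  if q = 0 then (p : EReal) * slopeAtTop f
  else if p = 0 then (q : EReal) * valueAtZero f
  else ((q * f (p / q) : ℝ) : EReal)

/-- The `f`-divergence `D_f(P ‖ Q) = ∑ x, Q(x) * f(P(x) / Q(x))` of two discrete distributions. -/
def fDiv {ι : Type*} (f : ℝ → ℝ) (P Q : ι → ℝ) : EReal :=
  esum fun x => fDivTerm f (P x) (Q x)

/-- The convex conjugate `f*(y) = sup_{t > 0} (t * y - f t)`, with values in `(-∞, ∞]`. -/
def conjugate (f : ℝ → ℝ) (y : ℝ) : EReal :=
  ⨆ t ∈ Ioi (0 : ℝ), ((t * y - f t : ℝ) : EReal)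

namespace TokenMDP

variable {A : Type*} (M : TokenMDP A)

/-- The distribution-matching objective `D_f(μ_π ‖ μ_E) + β D_KL(π ‖ π_ref)`. -/
def matchingObjective (f : ℝ → ℝ) (β : ℝ) (πE πref π : Policy A) : EReal :=
  fDiv f (M.stateAction π) (M.stateAction πE) + (β : EReal) * (M.policyKL π πref : EReal)

/-- The regularized return `J(π) = E_{μ_π}[r] - β D_KL(π ‖ π_ref)` of `π` for the reward `r`. -/
def regularizedReturn (β : ℝ) (πref : Policy A) (r : List A × A → ℝ) (π : Policy A) : EReal :=
  ((∑' x, M.stateAction π x * r x : ℝ) : EReal) - (β : EReal) * (M.policyKL π πref : EReal)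

/-- The reward objective `E_{μ_E}[f*(-r)] + sup_π (E_{μ_π}[r] - β D_KL(π ‖ π_ref))`. -/
def rewardObjective (f : ℝ → ℝ) (β : ℝ) (πE πref : Policy A) (r : List A × A → ℝ) : EReal :=
  (esum fun x => (M.stateAction πE x : EReal) * conjugate f (-(r x))) +
    ⨆ π : Policy A, M.regularizedReturn β πref r π

/-- The rewards whose expectation under every policy converges absolutely. -/
def IntegrableReward (r : List A × A → ℝ) : Prop :=
  ∀ π : Policy A, Summable fun x => M.stateAction π x * |r x|

end TokenMDP

/-- Bounded rewards. -/
def BoundedReward {A : Type*} (r : List A × A → ℝ) : Prop := ∃ C : ℝ, ∀ x, |r x| ≤ C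

/-- The rewards for which `-r` takes its values in the effective domain of `f*`. -/
def AdmissibleReward {A : Type*} (f : ℝ → ℝ) (r : List A × A → ℝ) : Prop :=
  ∀ x, conjugate f (-(r x)) < ⊤

end TokenLevel

end

/-!
The identity is a minimax theorem: the matching objective is a supremum over rewards of functions
of the policy, the reward objective is what remains when the infimum over policies is taken first,
and the content is that supremum and infimum can be exchanged.

*The divergence as a supremum.* A convex generator `f` is its own biconjugate, boundary conventions
included (`fDivTerm_eq_iSup`), so that each summand `q f(p / q)` is the supremum of `p y - q f*(y)`
over `y` in the domain of `f*`. A subgradient `y₀` of `f` at `1` satisfies `f*(y₀) = y₀`;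
subtracting its affine minorant `y₀ (p - q)`, whose sum over all points vanishes for probability
vectors, leaves nonnegative terms (`fDiv_eq_tsum_excess`). Hence dual variables that differ from
`y₀` at finitely many points suffice (`exists_lt_gain_add`); with `r = -y` they are bounded
admissible rewards. The same inequality between a summand and its minorants, summed, is weak
duality (`neg_matchingObjective_le`).

*Compactness and convexity.* Since transitions append one token, the flow equation expresses the
occupancy of `s ++ [a]` through that of `s` (`flowCoeff_mul_occupancy`). By induction along the
context, occupancies are continuous in the policy for pointwise convergence, for which the space of
policies is compact, and a convex combination of state-action distributions is again one
(`exists_mix`). The Kullback-Leibler regularizer is a sum of suprema of linear functions of the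
state-action distribution (`policyKL_eq_tsum`), so it is lower semicontinuous and convex. Hence
the matching objective attains its minimum, and the return of a bounded reward its maximum.

*Strong duality.* Let `c` lie below the matching objective of every policy. By compactness finitely
many dual variables certify this, and by separation in a finite-dimensional space
(`exists_weights_le_sum`) one convex combination of them certifies it for all policies at once
(`exists_dual_forall_le`).

*Optimal policies.* If `r` attains the infimum, there is no duality gap at a minimizer of the
matching objective, so that it maximizes the return for `r`. Conversely, mixing two policies that
differ at a context visited by both strictly lowers the regularizer (`policyKL_mix_lt`), so all
maximizers of the return share one state-action distribution
(`matchingObjective_eq_of_maximizers`), namely that of a minimizer.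
-/

namespace TokenLevel

/-! ### The convex conjugate of a divergence generator -/

/-- The effective domain `{y | f* y < ∞}` of the convex conjugate. -/
def conjDomain (f : ℝ → ℝ) : Set ℝ := {y | conjugate f y < ⊤}

/-- The convex conjugate as a real number; meaningful on `conjDomain f` only. -/
noncomputable def conjReal (f : ℝ → ℝ) (y : ℝ) : ℝ := (conjugate f y).toReal

variable {f : ℝ → ℝ}

lemma le_conjugate {t : ℝ} (ht : 0 < t) (y : ℝ) :
    ((t * y - f t : ℝ) : EReal) ≤ conjugate f y :=
  le_iSup₂ (f := fun (t : ℝ) (_ : t ∈ Ioi (0 : ℝ)) => ((t * y - f t : ℝ) : EReal)) t ht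

lemma conjugate_ne_bot (y : ℝ) : conjugate f y ≠ ⊥ :=
  ne_bot_of_le_ne_bot (EReal.coe_ne_bot _) (le_conjugate one_pos y)

lemma coe_conjReal {y : ℝ} (hy : y ∈ conjDomain f) : (conjReal f y : EReal) = conjugate f y :=
  EReal.coe_toReal (ne_of_lt hy) (conjugate_ne_bot y)

/-- The Fenchel-Young inequality. -/
lemma mul_sub_le_conjReal {y t : ℝ} (hy : y ∈ conjDomain f) (ht : 0 < t) :
    t * y - f t ≤ conjReal f y := by
  have h := le_conjugate (f := f) ht y
  rwa [← coe_conjReal hy, EReal.coe_le_coe_iff] at h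

lemma conjReal_le {y c : ℝ} (h : ∀ t, 0 < t → t * y - f t ≤ c) :
    y ∈ conjDomain f ∧ conjReal f y ≤ c := by
  have h1 : conjugate f y ≤ (c : EReal) := iSup₂_le fun t ht => EReal.coe_le_coe_iff.2 (h t ht)
  have h2 : y ∈ conjDomain f := h1.trans_lt (EReal.coe_lt_top c)
  refine ⟨h2, ?_⟩
  rwa [← coe_conjReal h2, EReal.coe_le_coe_iff] at h1

/-- The right derivative is a subgradient. -/
lemma rightDeriv_mul_sub_le (hf : ConvexOn ℝ (Ioi 0) f) {t s : ℝ} (ht : 0 < t) (hs : 0 < s) :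
    f t + derivWithin f (Ioi t) t * (s - t) ≤ f s := by
  have hti : t ∈ interior (Ioi (0 : ℝ)) := by simpa using ht
  rcases lt_trichotomy s t with h | h | h
  · have h1 := hf.slope_le_leftDeriv_of_mem_interior hs hti h
    have h2 := hf.leftDeriv_le_rightDeriv_of_mem_interior hti
    have h3 := h1.trans h2
    rw [slope_def_field, div_le_iff₀ (by linarith)] at h3
    linarith
  · simp [h]
  · have h1 := hf.rightDeriv_le_slope_of_mem_interior hti hs h
    rw [slope_def_field, le_div_iff₀ (by linarith)] at h1
    linarith

/-- Equality holds in the Fenchel-Young inequality at a subgradient. -/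
lemma conjReal_rightDeriv (hf : ConvexOn ℝ (Ioi 0) f) {t : ℝ} (ht : 0 < t) :
    derivWithin f (Ioi t) t ∈ conjDomain f ∧
      conjReal f (derivWithin f (Ioi t) t) = t * derivWithin f (Ioi t) t - f t := by
  obtain ⟨h1, h2⟩ := conjReal_le (f := f) (y := derivWithin f (Ioi t) t)
    (c := t * derivWithin f (Ioi t) t - f t) fun s hs => by
      have := rightDeriv_mul_sub_le hf ht hs
      linarith
  exact ⟨h1, h2.antisymm (mul_sub_le_conjReal h1 ht)⟩

lemma convexOn_conjReal : ConvexOn ℝ (conjDomain f) (conjReal f) := by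
  have key : ∀ y ∈ conjDomain f, ∀ z ∈ conjDomain f, ∀ a b : ℝ, 0 ≤ a → 0 ≤ b → a + b = 1 →
      a * y + b * z ∈ conjDomain f ∧
        conjReal f (a * y + b * z) ≤ a * conjReal f y + b * conjReal f z := by
    intro y hy z hz a b ha hb hab
    refine conjReal_le fun t ht => ?_
    have h1 := mul_le_mul_of_nonneg_left (mul_sub_le_conjReal hy ht) ha
    have h2 := mul_le_mul_of_nonneg_left (mul_sub_le_conjReal hz ht) hb
    have : f t = a * f t + b * f t := by rw [← add_mul, hab, one_mul]
    linarith
  exact ⟨fun y hy z hz a b ha hb hab => (key y hy z hz a b ha hb hab).1,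
    fun y hy z hz a b ha hb hab => (key y hy z hz a b ha hb hab).2⟩

/-- A subgradient of `f` at `1`. Since `f 1 = 0`, it is a fixed point of `f*`. -/
noncomputable def basePoint (f : ℝ → ℝ) : ℝ := derivWithin f (Ioi 1) 1

lemma basePoint_mem (hf : IsDivergenceGenerator f) : basePoint f ∈ conjDomain f :=
  (conjReal_rightDeriv hf.convexOn one_pos).1

lemma conjReal_basePoint (hf : IsDivergenceGenerator f) :
    conjReal f (basePoint f) = basePoint f := by
  have := (conjReal_rightDeriv hf.convexOn one_pos).2
  rw [hf.map_one, one_mul, sub_zero] at this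
  exact this

/-- A subgradient at `t` is compared with the secant from `t` to `1`. -/
lemma add_rightDeriv_mul_nonpos (hf : IsDivergenceGenerator f) {t : ℝ} (ht : 0 < t) :
    f t + derivWithin f (Ioi t) t * (1 - t) ≤ 0 := by
  simpa [hf.map_one] using rightDeriv_mul_sub_le hf.convexOn ht one_pos

/-- The value at zero is the supremum of `-f*`. -/
lemma exists_lt_neg_conjReal (hf : IsDivergenceGenerator f) {c : ℝ}
    (hc : (c : EReal) < valueAtZero f) : ∃ y ∈ conjDomain f, c < -conjReal f y := by
  obtain ⟨d, hcd, hd⟩ := EReal.exists_between_coe_real hc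
  rw [EReal.coe_lt_coe_iff] at hcd
  have h1 : ∃ᶠ t in 𝓝[>] (0 : ℝ), (d : EReal) < (f t : EReal) :=
    frequently_lt_of_lt_limsup (by isBoundedDefault) hd
  have h2 : ∀ᶠ t in 𝓝[>] (0 : ℝ), c * (1 - t) < d := by
    have : Tendsto (fun t : ℝ => c * (1 - t)) (𝓝[>] 0) (𝓝 (c * (1 - 0))) :=
      ((continuous_const.mul (continuous_const.sub continuous_id)).tendsto 0).mono_left
        nhdsWithin_le_nhds
    exact this.eventually_lt_const (by simpa using hcd)
  have h3 : ∀ᶠ t in 𝓝[>] (0 : ℝ), t < 1 :=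
    (eventually_lt_nhds one_pos).filter_mono nhdsWithin_le_nhds
  obtain ⟨t, ht, ht2, ht3, ht0⟩ := (h1.and_eventually
    (h2.and (h3.and self_mem_nhdsWithin))).exists
  obtain ⟨h4, h5⟩ := conjReal_rightDeriv hf.convexOn ht0
  refine ⟨_, h4, ?_⟩
  rw [h5]
  have h6 := add_rightDeriv_mul_nonpos hf ht0
  rw [EReal.coe_lt_coe_iff] at ht
  have ht0' : 0 < t := ht0
  by_contra! h7
  have h8 := mul_le_mul_of_nonneg_right h7 (by linarith : 0 ≤ 1 - t)
  nlinarith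

/-- The slope at infinity is the supremum of the domain of `f*`. -/
lemma exists_lt_mem_conjDomain (hf : IsDivergenceGenerator f) {c : ℝ}
    (hc : (c : EReal) < slopeAtTop f) : ∃ y ∈ conjDomain f, c < y := by
  obtain ⟨d, hcd, hd⟩ := EReal.exists_between_coe_real hc
  rw [EReal.coe_lt_coe_iff] at hcd
  have h1 : ∃ᶠ t in (atTop : Filter ℝ), (d : EReal) < ((f t / t : ℝ) : EReal) :=
    frequently_lt_of_lt_limsup (by isBoundedDefault) hd
  have h2 : ∀ᶠ t in (atTop : Filter ℝ), -c < t * (d - c) :=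
    (tendsto_id.atTop_mul_const (by linarith : 0 < d - c)).eventually_gt_atTop (-c)
  obtain ⟨t, ht, ht2, ht1⟩ := (h1.and_eventually (h2.and (eventually_gt_atTop 1))).exists
  have ht0 : 0 < t := by linarith
  refine ⟨_, (conjReal_rightDeriv hf.convexOn ht0).1, ?_⟩
  have h6 := add_rightDeriv_mul_nonpos hf ht0
  rw [EReal.coe_lt_coe_iff, lt_div_iff₀ ht0] at ht
  by_contra! h7
  have h8 := mul_le_mul_of_nonneg_right h7 (by linarith : 0 ≤ t - 1)
  nlinarith

lemma neg_conjReal_le_valueAtZero {y : ℝ} (hy : y ∈ conjDomain f) :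
    ((-conjReal f y : ℝ) : EReal) ≤ valueAtZero f := by
  have h : Tendsto (fun t : ℝ => ((t * y - conjReal f y : ℝ) : EReal)) (𝓝[>] 0)
      (𝓝 ((0 * y - conjReal f y : ℝ) : EReal)) :=
    ((continuous_coe_real_ereal.comp (by fun_prop)).tendsto 0).mono_left nhdsWithin_le_nhds
  rw [zero_mul, zero_sub] at h
  rw [← h.limsup_eq]
  refine limsup_le_limsup ?_
  filter_upwards [self_mem_nhdsWithin] with t ht
  rw [EReal.coe_le_coe_iff]
  linarith [mul_sub_le_conjReal hy ht]

lemma le_slopeAtTop {y : ℝ} (hy : y ∈ conjDomain f) : (y : EReal) ≤ slopeAtTop f := by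
  have h0 : Tendsto (fun t : ℝ => y - conjReal f y / t) atTop (𝓝 (y - 0)) :=
    tendsto_const_nhds.sub (tendsto_const_nhds.div_atTop tendsto_id)
  have h : Tendsto (fun t : ℝ => ((y - conjReal f y / t : ℝ) : EReal)) atTop (𝓝 (y : EReal)) := by
    rw [sub_zero] at h0
    exact (continuous_coe_real_ereal.tendsto y).comp h0
  rw [← h.limsup_eq]
  refine limsup_le_limsup ?_
  filter_upwards [eventually_gt_atTop 0] with t ht
  rw [EReal.coe_le_coe_iff, le_div_iff₀ ht, sub_mul, div_mul_cancel₀ _ ht.ne']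
  linarith [mul_sub_le_conjReal hy ht]

/-- Fenchel-Young for the summands of an `f`-divergence, boundary cases included. -/
lemma le_fDivTerm {p q y : ℝ} (hp : 0 ≤ p) (hq : 0 ≤ q) (hy : y ∈ conjDomain f) :
    ((p * y - q * conjReal f y : ℝ) : EReal) ≤ fDivTerm f p q := by
  unfold fDivTerm
  split_ifs with h1 h2
  · rw [h1, zero_mul, sub_zero, EReal.coe_mul]
    exact mul_le_mul_of_nonneg_left (le_slopeAtTop hy) (EReal.coe_nonneg.2 hp)
  · rw [h2, zero_mul, zero_sub, ← mul_neg, EReal.coe_mul]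
    exact mul_le_mul_of_nonneg_left (neg_conjReal_le_valueAtZero hy) (EReal.coe_nonneg.2 hq)
  · have hp' : 0 < p := lt_of_le_of_ne hp (Ne.symm h2)
    have hq' : 0 < q := lt_of_le_of_ne hq (Ne.symm h1)
    rw [EReal.coe_le_coe_iff]
    have h := mul_le_mul_of_nonneg_left (mul_sub_le_conjReal hy (div_pos hp' hq')) hq
    have e : q * (p / q * y - f (p / q)) = p * y - q * f (p / q) := by
      field_simp
    linarith

/-- The summands of an `f`-divergence are suprema of affine functions: `f` is its own
biconjugate, boundary cases included. -/
lemma fDivTerm_eq_iSup (hf : IsDivergenceGenerator f) {p q : ℝ} (hp : 0 ≤ p) (hq : 0 ≤ q) :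
    fDivTerm f p q = ⨆ y : conjDomain f, ((p * y - q * conjReal f y : ℝ) : EReal) := by
  refine le_antisymm ?_ (iSup_le fun y => le_fDivTerm hp hq y.2)
  have key : ∀ {c : ℝ}, (∃ y ∈ conjDomain f, c < p * y - q * conjReal f y) →
      ((c : ℝ) : EReal) ≤ ⨆ y : conjDomain f, ((p * y - q * conjReal f y : ℝ) : EReal) := by
    rintro c ⟨y, hy, h⟩
    exact (EReal.coe_le_coe_iff.2 h.le).trans
      (le_iSup (fun y : conjDomain f => ((p * y - q * conjReal f y : ℝ) : EReal)) ⟨y, hy⟩)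
  unfold fDivTerm
  split_ifs with h1 h2
  · subst h1
    rcases hp.eq_or_lt with rfl | hp'
    · simp only [EReal.coe_zero, zero_mul, sub_zero]
      exact le_iSup_of_le ⟨_, basePoint_mem hf⟩ le_rfl
    · refine EReal.ge_of_forall_gt_iff_ge.1 fun c hc => key ?_
      have : ((c / p : ℝ) : EReal) < slopeAtTop f := by
        by_contra! h
        have := mul_le_mul_of_nonneg_left h (EReal.coe_nonneg.2 hp)
        rw [← EReal.coe_mul, mul_div_cancel₀ _ hp'.ne'] at this
        exact absurd hc (not_lt.2 this)
      obtain ⟨y, hy, h⟩ := exists_lt_mem_conjDomain hf this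
      exact ⟨y, hy, by rw [div_lt_iff₀ hp'] at h; linarith⟩
  · subst h2
    have hq' : 0 < q := lt_of_le_of_ne hq (Ne.symm h1)
    refine EReal.ge_of_forall_gt_iff_ge.1 fun c hc => key ?_
    have : ((c / q : ℝ) : EReal) < valueAtZero f := by
      by_contra! h
      have := mul_le_mul_of_nonneg_left h (EReal.coe_nonneg.2 hq)
      rw [← EReal.coe_mul, mul_div_cancel₀ _ hq'.ne'] at this
      exact absurd hc (not_lt.2 this)
    obtain ⟨y, hy, h⟩ := exists_lt_neg_conjReal hf this
    exact ⟨y, hy, by rw [div_lt_iff₀ hq'] at h; linarith⟩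
  · have hp' : 0 < p := lt_of_le_of_ne hp (Ne.symm h2)
    have hq' : 0 < q := lt_of_le_of_ne hq (Ne.symm h1)
    obtain ⟨h4, h5⟩ := conjReal_rightDeriv hf.convexOn (div_pos hp' hq')
    refine le_iSup_of_le ⟨_, h4⟩ ?_
    rw [EReal.coe_le_coe_iff, h5]
    apply le_of_eq
    field_simp
    ring

/-- The amount by which the affine minorant of an `f`-divergence summand with slope `y` exceeds the
one with slope `basePoint f`. -/
noncomputable def tilt (f : ℝ → ℝ) (p q y : ℝ) : ℝ :=
  p * (y - basePoint f) - q * (conjReal f y - basePoint f)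

lemma tilt_basePoint (hf : IsDivergenceGenerator f) (p q : ℝ) : tilt f p q (basePoint f) = 0 := by
  simp [tilt, conjReal_basePoint hf]

/-- The nonnegative part of an `f`-divergence summand that is left after the affine minorant with
slope `basePoint f` is subtracted. -/
noncomputable def excess (f : ℝ → ℝ) (p q : ℝ) : ℝ≥0∞ :=
  ⨆ y : conjDomain f, ENNReal.ofReal (tilt f p q y)

lemma fDivTerm_eq_add_excess (hf : IsDivergenceGenerator f) {p q : ℝ} (hp : 0 ≤ p) (hq : 0 ≤ q) :
    fDivTerm f p q = ((basePoint f * (p - q) : ℝ) : EReal) + (excess f p q : EReal) := by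
  apply le_antisymm
  · rw [fDivTerm_eq_iSup hf hp hq]
    refine iSup_le fun y => ?_
    have e : p * y - q * conjReal f y = basePoint f * (p - q) + tilt f p q y := by
      unfold tilt; ring
    rw [e, EReal.coe_add]
    refine add_le_add le_rfl ?_
    calc ((tilt f p q y : ℝ) : EReal) ≤ ((ENNReal.ofReal (tilt f p q y) : ℝ≥0∞) : EReal) := by
          rw [EReal.coe_ennreal_ofReal, EReal.coe_le_coe_iff]; exact le_max_left _ _
      _ ≤ _ := EReal.coe_ennreal_le_coe_ennreal_iff.2
          (le_iSup (fun y : conjDomain f => ENNReal.ofReal (tilt f p q y)) y)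
  · have hle : ∀ y ∈ conjDomain f,
        ((basePoint f * (p - q) + tilt f p q y : ℝ) : EReal) ≤ fDivTerm f p q := by
      intro y hy
      refine le_trans (le_of_eq ?_) (le_fDivTerm hp hq hy)
      congr 1; unfold tilt; ring
    have h0 := hle _ (basePoint_mem hf)
    rw [tilt_basePoint hf, add_zero] at h0
    induction h : fDivTerm f p q using EReal.rec with
    | bot => rw [h] at h0; exact absurd (le_bot_iff.1 h0) (EReal.coe_ne_bot _)
    | top => exact le_top
    | coe t =>
      rw [h, EReal.coe_le_coe_iff] at h0
      have h1 : excess f p q ≤ ENNReal.ofReal (t - basePoint f * (p - q)) := by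
        refine iSup_le fun y => ENNReal.ofReal_le_ofReal ?_
        have := hle y y.2
        rw [h, EReal.coe_le_coe_iff] at this
        linarith
      calc _ ≤ ((basePoint f * (p - q) : ℝ) : EReal) +
            ((ENNReal.ofReal (t - basePoint f * (p - q)) : ℝ≥0∞) : EReal) :=
            add_le_add le_rfl (EReal.coe_ennreal_le_coe_ennreal_iff.2 h1)
        _ = t := by
          rw [EReal.coe_ennreal_ofReal, max_eq_left (by linarith), ← EReal.coe_add]
          congr 1; ring

variable {ι : Type*}

/-! ### The variational formula for an `f`-divergence -/

lemma summable_posPart {h : ι → ℝ} (hh : Summable h) : Summable fun i => max (h i) 0 :=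
  Summable.of_nonneg_of_le (fun _ => le_max_right _ _)
    (fun _ => max_le (le_abs_self _) (abs_nonneg _)) hh.abs

lemma tsum_ofReal_ne_top {h : ι → ℝ} (hh : Summable h) : ∑' i, ENNReal.ofReal (h i) ≠ ∞ := by
  have : ∀ i, ENNReal.ofReal (h i) = ENNReal.ofReal (max (h i) 0) := by
    intro i
    rcases le_total (h i) 0 with h0 | h0 <;> simp [h0]
  simp_rw [this]
  rw [← ENNReal.ofReal_tsum_of_nonneg (fun _ => le_max_right _ _) (summable_posPart hh)]
  exact ENNReal.ofReal_ne_top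

lemma tsum_eq_toReal_sub {h : ι → ℝ} (hh : Summable h) :
    ∑' i, h i = (∑' i, ENNReal.ofReal (h i)).toReal - (∑' i, ENNReal.ofReal (-h i)).toReal := by
  rw [ENNReal.tsum_toReal_eq fun _ => ENNReal.ofReal_ne_top,
    ENNReal.tsum_toReal_eq fun _ => ENNReal.ofReal_ne_top]
  simp only [ENNReal.toReal_ofReal']
  rw [← (summable_posPart hh).tsum_sub (summable_posPart hh.neg)]
  refine tsum_congr fun i => ?_
  rcases le_total (h i) 0 with h0 | h0 <;> simp [h0]

/-- An extended-real sum splits into an absolutely convergent part and a nonnegative part. -/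
lemma esum_add {h : ι → ℝ} (hh : Summable h) (u : ι → ℝ≥0∞) :
    esum (fun i => (h i : EReal) + (u i : EReal))
      = ((∑' i, h i : ℝ) : EReal) + ((∑' i, u i : ℝ≥0∞) : EReal) := by
  -- the decomposition into positive and negative parts, with all subtractions cleared
  have hpt : ∀ i, u i + ENNReal.ofReal (h i) + (-((h i : EReal) + (u i : EReal))).toENNReal
      = ((h i : EReal) + (u i : EReal)).toENNReal + ENNReal.ofReal (-h i) := by
    intro i
    rcases eq_or_ne (u i) ∞ with hu | hu
    · simp [hu]
    · obtain ⟨v, hv0, hv⟩ : ∃ v : ℝ, 0 ≤ v ∧ u i = ENNReal.ofReal v :=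
        ⟨(u i).toReal, ENNReal.toReal_nonneg, (ENNReal.ofReal_toReal hu).symm⟩
      rw [hv, EReal.coe_ennreal_ofReal, max_eq_left hv0, ← EReal.coe_add, ← EReal.coe_neg,
        EReal.real_coe_toENNReal, EReal.real_coe_toENNReal]
      rw [← ENNReal.toReal_eq_toReal_iff' (by finiteness) (by finiteness),
        ENNReal.toReal_add (by finiteness) (by finiteness),
        ENNReal.toReal_add (by finiteness) (by finiteness),
        ENNReal.toReal_add (by finiteness) (by finiteness)]
      simp only [ENNReal.toReal_ofReal']
      rcases le_total (h i) 0 with h0 | h0 <;> rcases le_total (h i + v) 0 with h1 | h1 <;>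
        simp only [max_def] <;> split_ifs <;> linarith
  have hneg : ∀ i, (-((h i : EReal) + (u i : EReal))).toENNReal ≤ ENNReal.ofReal (-h i) := by
    intro i
    rw [← EReal.real_coe_toENNReal]
    refine EReal.toENNReal_le_toENNReal ?_
    rw [EReal.coe_neg, EReal.neg_le_neg_iff]
    exact le_add_of_nonneg_right (EReal.coe_ennreal_nonneg _)
  have hsum : ∑' i, u i + ∑' i, ENNReal.ofReal (h i)
      + ∑' i, (-((h i : EReal) + (u i : EReal))).toENNReal
      = ∑' i, ((h i : EReal) + (u i : EReal)).toENNReal + ∑' i, ENNReal.ofReal (-h i) := by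
    simp only [← ENNReal.tsum_add, hpt]
  have hH1 := tsum_ofReal_ne_top hh
  have hH2 := tsum_ofReal_ne_top hh.neg
  have hN : ∑' i, (-((h i : EReal) + (u i : EReal))).toENNReal ≠ ∞ :=
    ne_top_of_le_ne_top hH2 (ENNReal.tsum_le_tsum hneg)
  rw [tsum_eq_toReal_sub hh]
  unfold esum
  generalize ∑' i, (-((h i : EReal) + (u i : EReal))).toENNReal = N at *
  generalize ∑' i, ((h i : EReal) + (u i : EReal)).toENNReal = P at *
  generalize ∑' i, ENNReal.ofReal (h i) = H1 at *
  generalize ∑' i, ENNReal.ofReal (-h i) = H2 at *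
  generalize ∑' i, u i = U at *
  lift N to NNReal using hN
  lift H1 to NNReal using hH1
  lift H2 to NNReal using hH2
  rcases eq_or_ne U ∞ with rfl | hU
  · have hP : P = ∞ := by
      by_contra hP
      lift P to NNReal using hP
      simp [← ENNReal.coe_add] at hsum
    subst hP
    simp only [EReal.coe_ennreal_top, EReal.coe_add_top]
    exact EReal.top_sub_coe N
  · lift U to NNReal using hU
    have hP : P ≠ ∞ := by
      rintro rfl
      simp [← ENNReal.coe_add] at hsum
    lift P to NNReal using hP
    norm_cast at hsum
    have hs : (U : ℝ) + H1 + N = P + H2 := by exact_mod_cast hsum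
    change ((P : ℝ) : EReal) - ((N : ℝ) : EReal)
      = (((H1 : ℝ) - H2 : ℝ) : EReal) + ((U : ℝ) : EReal)
    rw [← EReal.coe_sub, ← EReal.coe_add]
    congr 1
    linarith

lemma esum_coe {h : ι → ℝ} (hh : Summable h) :
    esum (fun i => (h i : EReal)) = ((∑' i, h i : ℝ) : EReal) := by
  simpa using esum_add hh (fun _ => 0)

/-- Between probability vectors an `f`-divergence is a sum of nonnegative terms. -/
lemma fDiv_eq_tsum_excess (hf : IsDivergenceGenerator f) {P Q : ι → ℝ} (hP : ∀ i, 0 ≤ P i)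
    (hQ : ∀ i, 0 ≤ Q i) (hP1 : HasSum P 1) (hQ1 : HasSum Q 1) :
    fDiv f P Q = ((∑' i, excess f (P i) (Q i) : ℝ≥0∞) : EReal) := by
  have h : HasSum (fun i => basePoint f * (P i - Q i)) (basePoint f * (1 - 1)) :=
    (hP1.sub hQ1).mul_left _
  unfold fDiv
  simp_rw [fDivTerm_eq_add_excess hf (hP _) (hQ _)]
  rw [esum_add h.summable, h.tsum_eq]
  simp

/-- The dual variables of the variational formula: functions into the domain of `f*` that differ
from the base point at finitely many places. -/
def dualSet (f : ℝ → ℝ) (ι : Type*) : Set (ι → ℝ) :=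
  {y | (∀ i, y i ∈ conjDomain f) ∧ {i | y i ≠ basePoint f}.Finite}

/-- The dual objective `E_P[y] - E_Q[f*(y)]`, normalized by its value at the base point. -/
noncomputable def gain (f : ℝ → ℝ) (P Q y : ι → ℝ) : ℝ := ∑' i, tilt f (P i) (Q i) (y i)

lemma const_basePoint_mem_dualSet (hf : IsDivergenceGenerator f) :
    (fun _ => basePoint f) ∈ dualSet f ι :=
  ⟨fun _ => basePoint_mem hf, by simp⟩

lemma gain_const_basePoint (hf : IsDivergenceGenerator f) (P Q : ι → ℝ) :
    gain f P Q (fun _ => basePoint f) = 0 := by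
  simp [gain, tilt_basePoint hf]

lemma support_tilt_subset (hf : IsDivergenceGenerator f) (P Q y : ι → ℝ) :
    Function.support (fun i => tilt f (P i) (Q i) (y i)) ⊆ {i | y i ≠ basePoint f} := by
  intro i hi h
  exact hi (by simp only [h, tilt_basePoint hf])

lemma summable_tilt (hf : IsDivergenceGenerator f) (P Q : ι → ℝ) {y : ι → ℝ}
    (hy : y ∈ dualSet f ι) : Summable fun i => tilt f (P i) (Q i) (y i) :=
  summable_of_hasFiniteSupport (hy.2.subset (support_tilt_subset hf P Q y))

lemma gain_eq_sum (hf : IsDivergenceGenerator f) (P Q : ι → ℝ) {y : ι → ℝ}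
    (hy : y ∈ dualSet f ι) :
    gain f P Q y = ∑ i ∈ hy.2.toFinset, tilt f (P i) (Q i) (y i) := by
  refine tsum_eq_sum fun i hi => ?_
  simp only [Finite.mem_toFinset, mem_ofPred_eq, not_not] at hi
  rw [hi, tilt_basePoint hf]

lemma hasSum_mul_of_finite {P z : ι → ℝ} {b : ℝ} (hP : HasSum P 1) (hz : {i | z i ≠ b}.Finite) :
    HasSum (fun i => P i * z i) (b + ∑' i, P i * (z i - b)) := by
  have h1 : Summable fun i => P i * (z i - b) := by
    refine summable_of_hasFiniteSupport (hz.subset fun i hi h => hi ?_)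
    simp only [h, sub_self, mul_zero]
  have h2 := (hP.mul_left b).add h1.hasSum
  rw [mul_one] at h2
  exact h2.congr_fun fun i => by ring

lemma finite_conjReal_ne (hf : IsDivergenceGenerator f) {y : ι → ℝ} (hy : y ∈ dualSet f ι) :
    {i | conjReal f (y i) ≠ basePoint f}.Finite :=
  hy.2.subset fun i hi h => hi (by rw [h, conjReal_basePoint hf])

lemma gain_eq_sub (hf : IsDivergenceGenerator f) {P Q y : ι → ℝ} (hP : HasSum P 1)
    (hQ : HasSum Q 1) (hy : y ∈ dualSet f ι) :
    gain f P Q y = ∑' i, P i * y i - ∑' i, Q i * conjReal f (y i) := by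
  have h1 := hasSum_mul_of_finite hP hy.2
  have h2 := hasSum_mul_of_finite hQ (finite_conjReal_ne hf hy)
  have h3 := (h1.sub h2).sub ((hP.sub hQ).mul_left (basePoint f))
  rw [h1.tsum_eq, h2.tsum_eq]
  have e : gain f P Q y = _ := (h3.congr_fun fun i => by unfold tilt; ring).tsum_eq
  rw [e]; ring

lemma tilt_linear (p₁ p₂ q y : ℝ) {a b : ℝ} (hab : a + b = 1) :
    tilt f (a * p₁ + b * p₂) q y = a * tilt f p₁ q y + b * tilt f p₂ q y := by
  obtain rfl : b = 1 - a := by linarith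
  unfold tilt; ring

lemma gain_linear (hf : IsDivergenceGenerator f) (P₁ P₂ Q : ι → ℝ) {y : ι → ℝ}
    (hy : y ∈ dualSet f ι) {a b : ℝ} (hab : a + b = 1) :
    gain f (fun i => a * P₁ i + b * P₂ i) Q y = a * gain f P₁ Q y + b * gain f P₂ Q y := by
  unfold gain
  rw [← tsum_mul_left, ← tsum_mul_left, ← Summable.tsum_add
    ((summable_tilt hf P₁ Q hy).mul_left a) ((summable_tilt hf P₂ Q hy).mul_left b)]
  exact tsum_congr fun i => tilt_linear _ _ _ _ hab

/-- The dual objective is concave in the dual variable. -/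
lemma exists_sum_gain_le (hf : IsDivergenceGenerator f) {κ : Type*} [Fintype κ] {Q : ι → ℝ}
    (hQ : ∀ i, 0 ≤ Q i) {y : κ → ι → ℝ} (hy : ∀ k, y k ∈ dualSet f ι) {w : κ → ℝ}
    (hw : ∀ k, 0 ≤ w k) (hw1 : ∑ k, w k = 1) :
    ∃ z ∈ dualSet f ι, ∀ P : ι → ℝ, ∑ k, w k * gain f P Q (y k) ≤ gain f P Q z := by
  have hz : (fun i => ∑ k, w k * y k i) ∈ dualSet f ι := by
    refine ⟨fun i => ?_, ?_⟩
    · have := convexOn_conjReal (f := f).1.sum_mem (t := Finset.univ) (w := w)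
        (z := fun k => y k i) (fun k _ => hw k) hw1 (fun k _ => (hy k).1 i)
      simpa using this
    · refine (finite_iUnion fun k => (hy k).2).subset fun i hi => ?_
      simp only [mem_iUnion, mem_ofPred_eq]
      by_contra! h
      refine hi ?_
      simp only [h]
      rw [← Finset.sum_mul, hw1, one_mul]
  refine ⟨_, hz, fun P => ?_⟩
  have h1 : ∑ k, w k * gain f P Q (y k) = ∑' i, ∑ k, w k * tilt f (P i) (Q i) (y k i) := by
    rw [Summable.tsum_finsetSum fun k _ => (summable_tilt hf P Q (hy k)).mul_left (w k)]
    exact Finset.sum_congr rfl fun k _ => tsum_mul_left.symm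
  rw [h1]
  refine Summable.tsum_le_tsum (fun i => ?_)
    (summable_sum fun k _ => (summable_tilt hf P Q (hy k)).mul_left (w k))
    (summable_tilt hf P Q hz)
  have h2 := convexOn_conjReal (f := f).map_sum_le (t := Finset.univ) (w := w)
    (p := fun k => y k i) (fun k _ => hw k) hw1 (fun k _ => (hy k).1 i)
  simp only [smul_eq_mul] at h2
  have h3 := mul_le_mul_of_nonneg_left h2 (hQ i)
  have h4 : ∑ k, w k * tilt f (P i) (Q i) (y k i)
      = P i * (∑ k, w k * y k i - basePoint f)
        - Q i * (∑ k, w k * conjReal f (y k i) - basePoint f) := by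
    have e : ∀ k, w k * tilt f (P i) (Q i) (y k i) = P i * (w k * y k i)
        - Q i * (w k * conjReal f (y k i)) - w k * ((P i - Q i) * basePoint f) := by
      intro k; unfold tilt; ring
    simp only [e, Finset.sum_sub_distrib, ← Finset.mul_sum, ← Finset.sum_mul, hw1]
    ring
  rw [h4]
  unfold tilt
  linarith

lemma exists_lt_ofReal_gain (hf : IsDivergenceGenerator f) {P Q : ι → ℝ} {a : ℝ≥0∞}
    (ha : a < ∑' i, excess f (P i) (Q i)) :
    ∃ y ∈ dualSet f ι, a < ENNReal.ofReal (gain f P Q y) := by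
  classical
  rw [ENNReal.tsum_eq_iSup_sum, lt_iSup_iff] at ha
  obtain ⟨s, hs⟩ := ha
  have hne : Nonempty (conjDomain f) := ⟨⟨_, basePoint_mem hf⟩⟩
  have e : ∀ i, excess f (P i) (Q i)
      = ⨆ Y : ι → conjDomain f, ENNReal.ofReal (tilt f (P i) (Q i) (Y i)) := fun i =>
    ((Function.surjective_eval (β := fun _ : ι => conjDomain f) i).iSup_comp
      (g := fun y : conjDomain f => ENNReal.ofReal (tilt f (P i) (Q i) y))).symm
  simp_rw [e] at hs
  rw [ENNReal.finsetSum_iSup, lt_iSup_iff] at hs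
  · obtain ⟨Y, hY⟩ := hs
    have hy : (fun i => if i ∈ s ∧ 0 ≤ tilt f (P i) (Q i) (Y i) then (Y i : ℝ) else basePoint f)
        ∈ dualSet f ι := by
      refine ⟨fun i => ?_, s.finite_toSet.subset fun i hi => ?_⟩
      · dsimp only
        split_ifs
        exacts [(Y i).2, basePoint_mem hf]
      · by_contra h
        exact hi (if_neg fun h' => h h'.1)
    refine ⟨_, hy, hY.trans_le (le_of_eq ?_)⟩
    rw [gain, tsum_eq_sum (s := s), ENNReal.ofReal_sum_of_nonneg]
    · refine Finset.sum_congr rfl fun i hi => ?_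
      split_ifs with h
      · rfl
      · rw [tilt_basePoint hf, ENNReal.ofReal_zero]
        exact ENNReal.ofReal_of_nonpos (le_of_not_ge fun h' => h ⟨hi, h'⟩)
    · intro i hi
      split_ifs with h
      exacts [h.2, (tilt_basePoint hf _ _).ge]
    · intro i hi
      rw [if_neg fun h => hi h.1, tilt_basePoint hf]
  · intro Y Z
    refine ⟨fun i => if tilt f (P i) (Q i) (Y i) ≤ tilt f (P i) (Q i) (Z i) then Z i else Y i,
      fun i => ?_⟩
    dsimp only
    split_ifs with h
    · exact ⟨ENNReal.ofReal_le_ofReal h, le_rfl⟩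
    · exact ⟨le_rfl, ENNReal.ofReal_le_ofReal (le_of_not_ge h)⟩

/-- An `f`-divergence plus a penalty `k` is the supremum of the dual objective plus `k`. -/
lemma exists_lt_gain_add (hf : IsDivergenceGenerator f) {P Q : ι → ℝ} {c : ℝ} {k : ℝ≥0∞}
    (hc : (c : EReal) < ((∑' i, excess f (P i) (Q i) : ℝ≥0∞) : EReal) + (k : EReal)) :
    ∃ y ∈ dualSet f ι, (c : EReal) < (gain f P Q y : EReal) + (k : EReal) := by
  rcases eq_or_ne k ∞ with rfl | hk
  · exact ⟨_, const_basePoint_mem_dualSet hf, by simp [EReal.coe_lt_top]⟩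
  lift k to NNReal using hk
  rcases lt_or_ge (c - k) 0 with h | h
  · refine ⟨_, const_basePoint_mem_dualSet hf, ?_⟩
    rw [gain_const_basePoint hf]
    change (c : EReal) < ((0 : ℝ) : EReal) + ((k : ℝ) : EReal)
    rw [← EReal.coe_add, EReal.coe_lt_coe_iff]
    linarith
  · have h1 : ENNReal.ofReal (c - k) < ∑' i, excess f (P i) (Q i) := by
      by_contra! h1
      refine absurd hc (not_lt.2 ?_)
      refine (add_le_add (EReal.coe_ennreal_le_coe_ennreal_iff.2 h1) le_rfl).trans ?_
      rw [EReal.coe_ennreal_ofReal, max_eq_left h]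
      change (((c - k : ℝ) : EReal)) + ((k : ℝ) : EReal) ≤ c
      rw [← EReal.coe_add, sub_add_cancel]
    obtain ⟨y, hy, h2⟩ := exists_lt_ofReal_gain hf h1
    refine ⟨y, hy, ?_⟩
    have h3 := (ENNReal.ofReal_lt_ofReal_iff_of_nonneg h).1 h2
    change (c : EReal) < ((gain f P Q y : ℝ) : EReal) + ((k : ℝ) : EReal)
    rw [← EReal.coe_add, EReal.coe_lt_coe_iff]
    linarith

/-! ### The compact space of policies -/

section Topology

variable {A : Type*}

/-- The topology of pointwise convergence of the probabilities. -/
instance instTopologicalSpacePMF : TopologicalSpace (PMF A) :=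
  TopologicalSpace.induced (fun p a => (p a).toReal) inferInstance

lemma continuous_pmf_toReal (a : A) : Continuous fun p : PMF A => (p a).toReal :=
  (continuous_apply a).comp
    (continuous_induced_dom (f := fun (p : PMF A) (a : A) => (p a).toReal))

lemma continuous_policy_toReal (s : List A) (a : A) :
    Continuous fun π : Policy A => (π s a).toReal :=
  (continuous_pmf_toReal a).comp (continuous_apply s)

variable [Fintype A]

lemma sum_toReal_pmf (p : PMF A) : ∑ a, (p a).toReal = 1 := by
  rw [← ENNReal.toReal_sum fun a _ => p.apply_ne_top a, ← tsum_fintype (L := .unconditional _),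
    p.tsum_coe, ENNReal.toReal_one]

/-- The probability mass function with the given nonnegative weights of sum one. -/
noncomputable def pmfOfReal (w : A → ℝ) (hw : ∀ a, 0 ≤ w a) (hw1 : ∑ a, w a = 1) : PMF A :=
  PMF.ofFintype (fun a => ENNReal.ofReal (w a))
    (by rw [← ENNReal.ofReal_sum_of_nonneg fun a _ => hw a, hw1, ENNReal.ofReal_one])

lemma toReal_pmfOfReal (w : A → ℝ) (hw : ∀ a, 0 ≤ w a) (hw1 : ∑ a, w a = 1) (a : A) :
    (pmfOfReal w hw hw1 a).toReal = w a := by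
  rw [pmfOfReal, PMF.ofFintype_apply, ENNReal.toReal_ofReal (hw a)]

instance instCompactSpacePMF : CompactSpace (PMF A) := by
  refine ⟨?_⟩
  have hind : IsInducing (fun (p : PMF A) (a : A) => (p a).toReal) := ⟨rfl⟩
  rw [hind.isCompact_iff]
  convert isCompact_stdSimplex ℝ A
  ext w
  constructor
  · rintro ⟨p, -, rfl⟩
    exact ⟨fun a => ENNReal.toReal_nonneg, sum_toReal_pmf p⟩
  · rintro ⟨h0, h1⟩
    exact ⟨pmfOfReal w h0 h1, mem_univ _, funext (toReal_pmfOfReal w h0 h1)⟩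

end Topology

/-! ### Occupancy measures -/

namespace TokenMDP

variable {A : Type*} (M : TokenMDP A)

open Classical in
lemma map_next_apply_of_mem {s : List A} (hs : s ∈ M.terminal) (p : PMF A) (t : List A) :
    p.map (M.next s) t = if t = s then 1 else 0 := by
  have : M.next s = Function.const A s := by
    funext a; simp [next, hs]
  rw [this, PMF.map_const, PMF.pure_apply]
  congr

lemma map_next_apply_nil {s : List A} (hs : s ∉ M.terminal) (p : PMF A) :
    p.map (M.next s) [] = 0 := by
  simp [PMF.map_apply, next, hs]

open Classical in
lemma map_next_apply_concat {s : List A} (hs : s ∉ M.terminal) (p : PMF A) (t : List A) (a : A) :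
    p.map (M.next s) (t ++ [a]) = if s = t then p a else 0 := by
  simp only [PMF.map_apply, next, hs, if_false]
  split_ifs with h
  · subst h
    simp [List.append_cancel_left_eq]
  · rw [ENNReal.tsum_eq_zero]
    intro b
    rw [if_neg]
    intro h'
    exact h (List.append_inj_left' h' rfl).symm

open Classical in
lemma stateLaw_succ_nil (π : Policy A) (i : ℕ) :
    M.stateLaw π (i + 1) [] = if [] ∈ M.terminal then M.stateLaw π i [] else 0 := by
  have : ∀ s, M.stateLaw π i s * (π s).map (M.next s) []
      = if s = [] then (if [] ∈ M.terminal then M.stateLaw π i [] else 0) else 0 := by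
    intro s
    by_cases hs : s ∈ M.terminal
    · rw [map_next_apply_of_mem M hs]
      by_cases h : s = []
      · subst h; simp [hs]
      · simp [h, Ne.symm h]
    · rw [map_next_apply_nil M hs]
      by_cases h : s = []
      · subst h; simp [hs]
      · simp [h]
  rw [stateLaw, PMF.bind_apply]
  simp_rw [this]
  rw [tsum_ite_eq]

open Classical in
lemma stateLaw_succ_concat (π : Policy A) (i : ℕ) (s : List A) (a : A) :
    M.stateLaw π (i + 1) (s ++ [a])
      = (if s ++ [a] ∈ M.terminal then M.stateLaw π i (s ++ [a]) else 0)
        + (if s ∈ M.terminal then 0 else M.stateLaw π i s * π s a) := by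
  have : ∀ t, M.stateLaw π i t * (π t).map (M.next t) (s ++ [a])
      = (if t = s ++ [a] then
          (if s ++ [a] ∈ M.terminal then M.stateLaw π i (s ++ [a]) else 0) else 0)
        + (if t = s then (if s ∈ M.terminal then 0 else M.stateLaw π i s * π s a) else 0) := by
    intro t
    by_cases ht : t ∈ M.terminal
    · rw [map_next_apply_of_mem M ht]
      have h2 : (if t = s then (if s ∈ M.terminal then 0 else M.stateLaw π i s * π s a) else 0)
          = 0 := by
        split_ifs with h3 h4
        · rfl
        · exact absurd (h3 ▸ ht) h4
        · rfl
      rw [h2, add_zero]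
      by_cases h : t = s ++ [a]
      · subst h; simp [ht]
      · simp [h, Ne.symm h]
    · rw [map_next_apply_concat M ht]
      have h1 : (if t = s ++ [a] then
          (if s ++ [a] ∈ M.terminal then M.stateLaw π i (s ++ [a]) else 0) else 0) = 0 := by
        split_ifs with h3 h4
        · exact absurd (h3 ▸ h4) ht
        · rfl
        · rfl
      rw [h1, zero_add]
      by_cases h : t = s
      · subst h; simp [ht]
      · simp [h]
  rw [stateLaw, PMF.bind_apply]
  simp_rw [this]
  rw [ENNReal.tsum_add, tsum_ite_eq, tsum_ite_eq]

lemma summable_discounted (π : Policy A) (s : List A) :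
    Summable fun i : ℕ => M.γ ^ i * (M.stateLaw π i s).toReal := by
  refine Summable.of_nonneg_of_le (fun i => mul_nonneg (pow_nonneg M.γ_nonneg i)
    ENNReal.toReal_nonneg) (fun i => ?_) (summable_geometric_of_lt_one M.γ_nonneg M.γ_lt_one)
  refine mul_le_of_le_one_right (pow_nonneg M.γ_nonneg i) ?_
  exact ENNReal.toReal_le_of_le_ofReal zero_le_one (by simpa using PMF.coe_le_one _ s)

lemma occupancy_nonneg (π : Policy A) (s : List A) : 0 ≤ M.occupancy π s :=
  mul_nonneg (by linarith [M.γ_lt_one]) (tsum_nonneg fun i =>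
    mul_nonneg (pow_nonneg M.γ_nonneg i) ENNReal.toReal_nonneg)

lemma stateAction_nonneg (π : Policy A) (x : List A × A) : 0 ≤ M.stateAction π x :=
  mul_nonneg ENNReal.toReal_nonneg (M.occupancy_nonneg π x.1)

open Classical in
/-- The coefficient of `ρ(s)` in the flow equation: a terminal context feeds back into itself. -/
noncomputable def flowCoeff (s : List A) : ℝ := 1 - if s ∈ M.terminal then M.γ else 0

lemma flowCoeff_pos (s : List A) : 0 < M.flowCoeff s := by
  unfold flowCoeff
  split_ifs <;> linarith [M.γ_lt_one]

open Classical in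
/-- The right-hand side of the flow equation: the discounted mass that enters a context from the
initial law and, for a context `s ++ [a]`, from `s`. The argument `m` stands for `μ_π`. -/
noncomputable def inflow (m : List A × A → ℝ) (s : List A) : ℝ :=
  (1 - M.γ) * (M.init s).toReal + match s.reverse with
    | [] => 0
    | a :: t => if t.reverse ∈ M.terminal then 0 else M.γ * m (t.reverse, a)

open Classical in
lemma inflow_concat (m : List A × A → ℝ) (s : List A) (a : A) :
    M.inflow m (s ++ [a]) = (1 - M.γ) * (M.init (s ++ [a])).toReal
      + if s ∈ M.terminal then 0 else M.γ * m (s, a) := by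
  simp [inflow]

/-- The flow equation of the occupancy measure. -/
lemma flowCoeff_mul_occupancy (π : Policy A) (s : List A) :
    M.flowCoeff s * M.occupancy π s = M.inflow (M.stateAction π) s := by
  classical
  have hshift : M.occupancy π s = (1 - M.γ) * (M.init s).toReal
      + M.γ * ((1 - M.γ) * ∑' i : ℕ, M.γ ^ i * (M.stateLaw π (i + 1) s).toReal) := by
    unfold occupancy
    rw [(M.summable_discounted π s).tsum_eq_zero_add]
    have : ∀ i : ℕ, M.γ ^ (i + 1) * (M.stateLaw π (i + 1) s).toReal
        = M.γ * (M.γ ^ i * (M.stateLaw π (i + 1) s).toReal) := fun i => by ring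
    simp_rw [this]
    rw [tsum_mul_left]
    simp only [pow_zero, one_mul, stateLaw]
    ring
  rcases List.eq_nil_or_concat s with rfl | ⟨t, a, rfl⟩
  · simp_rw [stateLaw_succ_nil] at hshift
    simp only [flowCoeff, inflow, List.reverse_nil, add_zero]
    split_ifs at hshift ⊢ with h
    · change M.occupancy π [] = _ + M.γ * M.occupancy π [] at hshift
      linarith
    · simp at hshift
      linarith
  · rw [List.concat_eq_append] at *
    rw [inflow_concat]
    have h1 : ∀ i, (M.stateLaw π (i + 1) (t ++ [a])).toReal
        = (if t ++ [a] ∈ M.terminal then (M.stateLaw π i (t ++ [a])).toReal else 0)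
          + (if t ∈ M.terminal then 0 else (π t a).toReal * (M.stateLaw π i t).toReal) := by
      intro i
      rw [stateLaw_succ_concat, ENNReal.toReal_add]
      · congr 1
        · split_ifs <;> rfl
        · split_ifs
          · rfl
          · rw [ENNReal.toReal_mul, mul_comm]
      · split_ifs
        exacts [PMF.apply_ne_top _ _, ENNReal.zero_ne_top]
      · split_ifs
        exacts [ENNReal.zero_ne_top, ENNReal.mul_ne_top (PMF.apply_ne_top _ _)
          (PMF.apply_ne_top _ _)]
    have h2 : (1 - M.γ) * ∑' i : ℕ, M.γ ^ i * (M.stateLaw π (i + 1) (t ++ [a])).toReal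
        = (if t ++ [a] ∈ M.terminal then M.occupancy π (t ++ [a]) else 0)
          + (if t ∈ M.terminal then 0 else M.stateAction π (t, a)) := by
      simp_rw [h1]
      unfold stateAction occupancy
      have hs1 := M.summable_discounted π (t ++ [a])
      have hs2 := (M.summable_discounted π t).mul_left (π t a).toReal
      have e2 : ∀ i : ℕ, M.γ ^ i * ((π t a).toReal * (M.stateLaw π i t).toReal)
        = (π t a).toReal * (M.γ ^ i * (M.stateLaw π i t).toReal) := fun i => by ring
      split_ifs
      · simp
      · simp only [mul_add, e2]
        rw [hs1.tsum_add hs2, tsum_mul_left]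
        ring
      · simp
      · simp only [zero_add, e2]
        rw [tsum_mul_left]
        ring
    rw [h2] at hshift
    unfold flowCoeff
    split_ifs at hshift ⊢ <;> linarith

/-- The flow equation determines the occupancy measure, by induction along the context. -/
lemma eq_occupancy_of_flow (π : Policy A) {ρ : List A → ℝ}
    (h : ∀ s, M.flowCoeff s * ρ s = M.inflow (fun x => (π x.1 x.2).toReal * ρ x.1) s) :
    ρ = M.occupancy π := by
  classical
  funext s
  induction s using List.reverseRecOn with
  | nil =>
    refine mul_left_cancel₀ (M.flowCoeff_pos []).ne' ?_
    rw [h, flowCoeff_mul_occupancy]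
    simp [inflow]
  | append_singleton s a ih =>
    refine mul_left_cancel₀ (M.flowCoeff_pos (s ++ [a])).ne' ?_
    rw [h, flowCoeff_mul_occupancy, inflow_concat, inflow_concat, stateAction]
    simp only [ih]

lemma continuous_occupancy (s : List A) : Continuous fun π : Policy A => M.occupancy π s := by
  classical
  have key : ∀ s, (fun π : Policy A => M.occupancy π s)
      = fun π => M.inflow (M.stateAction π) s / M.flowCoeff s := fun s => by
    funext π
    rw [← flowCoeff_mul_occupancy, mul_div_cancel_left₀ _ (M.flowCoeff_pos s).ne']
  induction s using List.reverseRecOn with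
  | nil =>
    rw [key]
    simp only [inflow, List.reverse_nil]
    exact continuous_const
  | append_singleton s a ih =>
    rw [key]
    simp only [inflow_concat]
    refine (continuous_const.add ?_).div_const _
    split_ifs
    · exact continuous_const
    · exact continuous_const.mul ((continuous_policy_toReal s a).mul ih)

lemma continuous_stateAction (x : List A × A) :
    Continuous fun π : Policy A => M.stateAction π x :=
  (continuous_policy_toReal x.1 x.2).mul (M.continuous_occupancy x.1)

lemma tsum_ofReal_occupancy (π : Policy A) : ∑' s, ENNReal.ofReal (M.occupancy π s) = 1 := by
  have h1γ : 0 < 1 - M.γ := by linarith [M.γ_lt_one]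
  have h : ∀ s, ENNReal.ofReal (M.occupancy π s)
      = ENNReal.ofReal (1 - M.γ) * ∑' i : ℕ, ENNReal.ofReal M.γ ^ i * M.stateLaw π i s := by
    intro s
    unfold occupancy
    rw [ENNReal.ofReal_mul h1γ.le, ENNReal.ofReal_tsum_of_nonneg (fun i =>
      mul_nonneg (pow_nonneg M.γ_nonneg i) ENNReal.toReal_nonneg) (M.summable_discounted π s)]
    congr 1
    refine tsum_congr fun i => ?_
    rw [ENNReal.ofReal_mul (pow_nonneg M.γ_nonneg i), ENNReal.ofReal_pow M.γ_nonneg,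
      ENNReal.ofReal_toReal (PMF.apply_ne_top _ _)]
  simp_rw [h]
  rw [ENNReal.tsum_mul_left, ENNReal.tsum_comm]
  simp_rw [ENNReal.tsum_mul_left, PMF.tsum_coe, mul_one]
  rw [ENNReal.tsum_geometric, ← ENNReal.ofReal_one, ← ENNReal.ofReal_sub _ M.γ_nonneg,
    ENNReal.ofReal_one]
  exact ENNReal.mul_inv_cancel (ENNReal.ofReal_pos.2 h1γ).ne' ENNReal.ofReal_ne_top

lemma hasSum_stateAction (π : Policy A) : HasSum (M.stateAction π) 1 := by
  have h : ∑' x, ENNReal.ofReal (M.stateAction π x) = 1 := by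
    have e : ∀ s a, ENNReal.ofReal (M.stateAction π (s, a))
        = π s a * ENNReal.ofReal (M.occupancy π s) := fun s a => by
      rw [stateAction, ENNReal.ofReal_mul ENNReal.toReal_nonneg,
        ENNReal.ofReal_toReal (PMF.apply_ne_top _ _)]
    rw [ENNReal.tsum_prod']
    simp_rw [e, ENNReal.tsum_mul_right, PMF.tsum_coe, one_mul]
    exact M.tsum_ofReal_occupancy π
  have h2 := ENNReal.hasSum_toReal (f := fun x => ENNReal.ofReal (M.stateAction π x))
    (by rw [h]; exact ENNReal.one_ne_top)
  rw [← ENNReal.tsum_toReal_eq fun x => ENNReal.ofReal_ne_top, h, ENNReal.toReal_one] at h2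
  exact h2.congr_fun fun x => (ENNReal.toReal_ofReal (M.stateAction_nonneg π x)).symm

/-- Occupancy measures are closed under convex combinations. -/
lemma exists_mix [Fintype A] (π₁ π₂ : Policy A) {a b : ℝ} (ha : 0 ≤ a) (hb : 0 ≤ b)
    (hab : a + b = 1) :
    ∃ π : Policy A, (∀ s, M.occupancy π s = a * M.occupancy π₁ s + b * M.occupancy π₂ s) ∧
      ∀ x, M.stateAction π x = a * M.stateAction π₁ x + b * M.stateAction π₂ x := by
  classical
  set ρ : List A → ℝ := fun s => a * M.occupancy π₁ s + b * M.occupancy π₂ s with hρ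
  set m : List A × A → ℝ := fun x => a * M.stateAction π₁ x + b * M.stateAction π₂ x with hm
  have hρ0 : ∀ s, 0 ≤ ρ s := fun s => add_nonneg (mul_nonneg ha (M.occupancy_nonneg _ _))
    (mul_nonneg hb (M.occupancy_nonneg _ _))
  have hm0 : ∀ x, 0 ≤ m x := fun x => add_nonneg (mul_nonneg ha (M.stateAction_nonneg _ _))
    (mul_nonneg hb (M.stateAction_nonneg _ _))
  have hsum : ∀ s, ∑ c, m (s, c) = ρ s := by
    intro s
    simp only [hm, hρ, stateAction, Finset.sum_add_distrib, ← Finset.mul_sum, ← Finset.sum_mul,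
      sum_toReal_pmf, one_mul]
  have hπ : ∀ s, ∃ p : PMF A, ∀ c, (p c).toReal * ρ s = m (s, c) := by
    intro s
    rcases (hρ0 s).eq_or_lt with h | h
    · -- a context of zero occupancy: every next-token distribution will do
      refine ⟨π₁ s, fun c => ?_⟩
      rw [← h, mul_zero]
      have := hsum s
      rw [← h] at this
      exact ((Finset.sum_eq_zero_iff_of_nonneg fun c _ => hm0 (s, c)).1 this c
        (Finset.mem_univ c)).symm
    · refine ⟨pmfOfReal (fun c => m (s, c) / ρ s) (fun c => div_nonneg (hm0 _) h.le) ?_,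
        fun c => ?_⟩
      · rw [← Finset.sum_div, hsum, div_self h.ne']
      · rw [toReal_pmfOfReal, div_mul_cancel₀ _ h.ne']
  choose π hπ using hπ
  have hocc : ρ = M.occupancy π := by
    refine M.eq_occupancy_of_flow π fun s => ?_
    simp only [hπ]
    have h1 := M.flowCoeff_mul_occupancy π₁ s
    have h2 := M.flowCoeff_mul_occupancy π₂ s
    have e : M.flowCoeff s * ρ s = a * M.inflow (M.stateAction π₁) s
        + b * M.inflow (M.stateAction π₂) s := by
      rw [← h1, ← h2]; simp only [hρ]; ring
    rw [e]
    have hi : (1 - M.γ) * (M.init s).toReal = a * ((1 - M.γ) * (M.init s).toReal)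
        + b * ((1 - M.γ) * (M.init s).toReal) := by rw [← add_mul, hab, one_mul]
    rcases List.eq_nil_or_concat s with rfl | ⟨t, c, rfl⟩
    · simp only [inflow, List.reverse_nil, add_zero]
      exact hi.symm
    · rw [List.concat_eq_append] at *
      simp only [inflow_concat, hm]
      split_ifs <;> linarith
  refine ⟨π, fun s => (congrFun hocc s).symm, fun x => ?_⟩
  rw [stateAction, ← congrFun hocc x.1, hπ]

end TokenMDP

/-! ### The Kullback-Leibler regularizer -/

/-- A summand of the Kullback-Leibler divergence of finite measures of weights `p` and `q` at a
point, `p * log (p / q) - p + q`, written as a supremum of functions that are linear in `(p, q)`. -/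
noncomputable def klTerm (p q : ℝ) : ℝ≥0∞ :=
  ⨆ y : ℝ, ENNReal.ofReal (p * y - q * (Real.exp y - 1))

open InformationTheory (klFun klFun_apply klFun_zero klFun_nonneg strictConvexOn_klFun)

lemma mul_sub_exp_le_klFun {t : ℝ} (ht : 0 ≤ t) (y : ℝ) :
    t * y - (Real.exp y - 1) ≤ klFun t := by
  rw [klFun_apply]
  rcases ht.eq_or_lt with rfl | ht
  · simp [Real.exp_nonneg]
  · have h := Real.add_one_le_exp (y - Real.log t)
    rw [Real.exp_sub, Real.exp_log ht, le_div_iff₀ ht] at h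
    linarith

lemma klTerm_of_pos {p q : ℝ} (hp : 0 ≤ p) (hq : 0 < q) :
    klTerm p q = ENNReal.ofReal (q * klFun (p / q)) := by
  apply le_antisymm
  · refine iSup_le fun y => ENNReal.ofReal_le_ofReal ?_
    have h := mul_le_mul_of_nonneg_left (mul_sub_exp_le_klFun (div_nonneg hp hq.le) y) hq.le
    have e : q * (p / q * y - (Real.exp y - 1)) = p * y - q * (Real.exp y - 1) := by field_simp
    rwa [e] at h
  · rcases hp.eq_or_lt with rfl | hp
    · -- the supremum is approached as `y → -∞`
      have h : Tendsto (fun y : ℝ => ENNReal.ofReal (0 * y - q * (Real.exp y - 1))) atBot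
          (𝓝 (ENNReal.ofReal (q * klFun (0 / q)))) := by
        refine ENNReal.tendsto_ofReal ?_
        have := ((Real.tendsto_exp_atBot.sub_const 1).const_mul q).neg
        simpa [klFun_zero] using this
      exact le_of_tendsto' h fun y =>
        le_iSup (fun y : ℝ => ENNReal.ofReal (0 * y - q * (Real.exp y - 1))) y
    · refine le_iSup_of_le (Real.log (p / q)) (le_of_eq ?_)
      rw [Real.exp_log (div_pos hp hq), klFun_apply]
      congr 1
      field_simp
      ring

lemma klTerm_zero_zero : klTerm 0 0 = 0 := by simp [klTerm]

lemma klTerm_zero_right {p : ℝ} (hp : 0 < p) : klTerm p 0 = ∞ := by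
  refine ENNReal.eq_top_of_forall_nnreal_le fun r => ?_
  refine le_iSup_of_le ((r : ℝ) / p) ?_
  rw [zero_mul, sub_zero, mul_div_cancel₀ _ hp.ne', ENNReal.ofReal_coe_nnreal]

lemma ofReal_mul_klTerm {c : ℝ} (hc : 0 ≤ c) (p q : ℝ) :
    ENNReal.ofReal c * klTerm p q = klTerm (c * p) (c * q) := by
  unfold klTerm
  rw [ENNReal.mul_iSup]
  refine iSup_congr fun y => ?_
  rw [← ENNReal.ofReal_mul hc]
  congr 1
  ring

lemma klTerm_add_le (p₁ q₁ p₂ q₂ : ℝ) {a b : ℝ} (ha : 0 ≤ a) (hb : 0 ≤ b) :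
    klTerm (a * p₁ + b * p₂) (a * q₁ + b * q₂)
      ≤ ENNReal.ofReal a * klTerm p₁ q₁ + ENNReal.ofReal b * klTerm p₂ q₂ := by
  rw [ofReal_mul_klTerm ha, ofReal_mul_klTerm hb]
  refine iSup_le fun y => ?_
  have e : (a * p₁ + b * p₂) * y - (a * q₁ + b * q₂) * (Real.exp y - 1)
      = (a * p₁ * y - a * q₁ * (Real.exp y - 1)) + (b * p₂ * y - b * q₂ * (Real.exp y - 1)) := by
    ring
  rw [e]
  exact ENNReal.ofReal_add_le.trans (add_le_add
    (le_iSup (fun y : ℝ => ENNReal.ofReal (a * p₁ * y - a * q₁ * (Real.exp y - 1))) y)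
    (le_iSup (fun y : ℝ => ENNReal.ofReal (b * p₂ * y - b * q₂ * (Real.exp y - 1))) y))

/-- The summand is strictly convex transversally to the rays along which it is homogeneous. -/
lemma klTerm_add_lt {p₁ q₁ p₂ q₂ a b : ℝ} (hp₁ : 0 ≤ p₁) (hq₁ : 0 < q₁) (hp₂ : 0 ≤ p₂)
    (hq₂ : 0 < q₂) (ha : 0 < a) (hb : 0 < b) (hne : p₁ / q₁ ≠ p₂ / q₂) :
    klTerm (a * p₁ + b * p₂) (a * q₁ + b * q₂)
      < ENNReal.ofReal a * klTerm p₁ q₁ + ENNReal.ofReal b * klTerm p₂ q₂ := by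
  have hq : 0 < a * q₁ + b * q₂ := by positivity
  rw [klTerm_of_pos (by positivity) hq, klTerm_of_pos hp₁ hq₁, klTerm_of_pos hp₂ hq₂,
    ← ENNReal.ofReal_mul ha.le, ← ENNReal.ofReal_mul hb.le]
  have h1 := klFun_nonneg (div_nonneg hp₁ hq₁.le)
  have h2 := klFun_nonneg (div_nonneg hp₂ hq₂.le)
  rw [← ENNReal.ofReal_add (by positivity) (by positivity)]
  have h := strictConvexOn_klFun.2 (mem_Ici.2 (div_nonneg hp₁ hq₁.le))
    (mem_Ici.2 (div_nonneg hp₂ hq₂.le)) hne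
    (show 0 < a * q₁ / (a * q₁ + b * q₂) by positivity)
    (show 0 < b * q₂ / (a * q₁ + b * q₂) by positivity) (by field_simp)
  simp only [smul_eq_mul] at h
  have e : a * q₁ / (a * q₁ + b * q₂) * (p₁ / q₁) + b * q₂ / (a * q₁ + b * q₂) * (p₂ / q₂)
      = (a * p₁ + b * p₂) / (a * q₁ + b * q₂) := by field_simp
  rw [e] at h
  have h3 := mul_lt_mul_of_pos_left h hq
  have e2 : (a * q₁ + b * q₂) * (a * q₁ / (a * q₁ + b * q₂) * klFun (p₁ / q₁)
      + b * q₂ / (a * q₁ + b * q₂) * klFun (p₂ / q₂))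
      = a * (q₁ * klFun (p₁ / q₁)) + b * (q₂ * klFun (p₂ / q₂)) := by
    field_simp
  rw [e2] at h3
  refine (ENNReal.ofReal_lt_ofReal_iff_of_nonneg ?_).2 h3
  exact mul_nonneg hq.le (klFun_nonneg (by positivity))

open scoped MeasureTheory

namespace TokenMDP

variable {A : Type*} (M : TokenMDP A)

lemma tokenKL_eq_sum [Fintype A] (p q : PMF A) :
    tokenKL p q = ∑ a, klTerm (p a).toReal (q a).toReal := by
  let : MeasurableSpace A := ⊤
  have hac : p.toMeasure ≪ q.toMeasure ↔ ∀ a, q a = 0 → p a = 0 := by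
    constructor
    · intro h a ha
      have := h (s := {a}) (by rw [PMF.toMeasure_apply_singleton _ _ (by trivial), ha])
      rwa [PMF.toMeasure_apply_singleton _ _ (by trivial)] at this
    · intro h s hs
      rw [PMF.toMeasure_apply_eq_zero_iff _ (by trivial)] at hs ⊢
      refine hs.mono_left fun a ha => ?_
      rw [PMF.mem_support_iff] at ha ⊢
      exact fun h' => ha (h a h')
  change InformationTheory.klDiv p.toMeasure q.toMeasure = _
  by_cases h : p.toMeasure ≪ q.toMeasure
  · rw [InformationTheory.klDiv_eq_lintegral_klFun_of_ac h, MeasureTheory.lintegral_fintype]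
    refine Finset.sum_congr rfl fun a _ => ?_
    rw [PMF.toMeasure_apply_singleton _ _ (by trivial)]
    rcases eq_or_ne (q a) 0 with hq | hq
    · rw [hq, hac.1 h a hq, mul_zero, ENNReal.toReal_zero, klTerm_zero_zero]
    · have hd : p.toMeasure.rnDeriv q.toMeasure a * q a = p a := by
        have e := congrArg (fun μ => μ {a}) (MeasureTheory.Measure.withDensity_rnDeriv_eq _ _ h)
        rw [MeasureTheory.withDensity_apply _ (by trivial), MeasureTheory.lintegral_singleton,
          PMF.toMeasure_apply_singleton _ _ (by trivial),
          PMF.toMeasure_apply_singleton _ _ (by trivial)] at e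
        exact e
      have hq0 : 0 < (q a).toReal := ENNReal.toReal_pos hq (PMF.apply_ne_top _ _)
      rw [klTerm_of_pos ENNReal.toReal_nonneg hq0, ENNReal.ofReal_mul hq0.le,
        ENNReal.ofReal_toReal (PMF.apply_ne_top _ _), mul_comm]
      congr 3
      rw [eq_div_iff hq0.ne', ← ENNReal.toReal_mul, hd]
  · rw [InformationTheory.klDiv_of_not_ac h]
    rw [hac] at h
    push Not at h
    obtain ⟨a, hq, hp⟩ := h
    symm
    rw [ENNReal.sum_eq_top]
    refine ⟨a, Finset.mem_univ a, ?_⟩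
    rw [hq, ENNReal.toReal_zero]
    exact klTerm_zero_right (ENNReal.toReal_pos hp (PMF.apply_ne_top _ _))

/-- The regularizer is the Kullback-Leibler divergence of `μ_π` from `ρ_π(s) * π_ref(a | s)`, hence
a function of the state-action distribution. -/
lemma policyKL_eq_tsum [Fintype A] (π πref : Policy A) :
    M.policyKL π πref = ∑' x : List A × A,
      klTerm (M.stateAction π x) (M.occupancy π x.1 * (πref x.1 x.2).toReal) := by
  rw [ENNReal.tsum_prod']
  unfold policyKL
  refine tsum_congr fun s => ?_
  rw [tokenKL_eq_sum, Finset.mul_sum, tsum_fintype]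
  refine Finset.sum_congr rfl fun a _ => ?_
  rw [ofReal_mul_klTerm (M.occupancy_nonneg π s), stateAction, mul_comm (M.occupancy π s)]

lemma policyKL_self (π : Policy A) : M.policyKL π π = 0 := by
  let : MeasurableSpace A := ⊤
  simp [policyKL, tokenKL]

lemma lowerSemicontinuous_policyKL [Fintype A] (πref : Policy A) :
    LowerSemicontinuous fun π : Policy A => M.policyKL π πref := by
  simp_rw [policyKL_eq_tsum]
  refine lowerSemicontinuous_tsum fun x => lowerSemicontinuous_iSup fun y => ?_
  refine (ENNReal.continuous_ofReal.comp ?_).lowerSemicontinuous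
  exact ((M.continuous_stateAction x).mul continuous_const).sub
    (((M.continuous_occupancy x.1).mul continuous_const).mul continuous_const)

variable {M} in
lemma policyKL_mix_le [Fintype A] {π π₁ π₂ πref : Policy A} {a b : ℝ} (ha : 0 ≤ a) (hb : 0 ≤ b)
    (hocc : ∀ s, M.occupancy π s = a * M.occupancy π₁ s + b * M.occupancy π₂ s)
    (hsa : ∀ x, M.stateAction π x = a * M.stateAction π₁ x + b * M.stateAction π₂ x) :
    M.policyKL π πref
      ≤ ENNReal.ofReal a * M.policyKL π₁ πref + ENNReal.ofReal b * M.policyKL π₂ πref := by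
  simp_rw [policyKL_eq_tsum, ← ENNReal.tsum_mul_left, ← ENNReal.tsum_add]
  refine ENNReal.tsum_le_tsum fun x => ?_
  rw [hsa, hocc, add_mul, mul_assoc, mul_assoc]
  exact klTerm_add_le _ _ _ _ ha hb

variable {M} in
/-- Strict convexity: mixing policies that differ at a context visited by both strictly lowers the
regularizer. -/
lemma policyKL_mix_lt [Fintype A] {π π₁ π₂ πref : Policy A} {a b : ℝ} (ha : 0 < a) (hb : 0 < b)
    (hocc : ∀ s, M.occupancy π s = a * M.occupancy π₁ s + b * M.occupancy π₂ s)
    (hsa : ∀ x, M.stateAction π x = a * M.stateAction π₁ x + b * M.stateAction π₂ x)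
    (h₁ : M.policyKL π₁ πref ≠ ∞) (h₂ : M.policyKL π₂ πref ≠ ∞) {s : List A}
    (hs₁ : 0 < M.occupancy π₁ s) (hs₂ : 0 < M.occupancy π₂ s) (hne : π₁ s ≠ π₂ s) :
    M.policyKL π πref
      < ENNReal.ofReal a * M.policyKL π₁ πref + ENNReal.ofReal b * M.policyKL π₂ πref := by
  obtain ⟨c, hc⟩ : ∃ c, π₁ s c ≠ π₂ s c := by
    by_contra! h
    exact hne (PMF.ext h)
  have hfin : M.policyKL π πref ≠ ∞ :=
    ne_top_of_le_ne_top (by finiteness) (policyKL_mix_le ha.le hb.le hocc hsa)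
  -- finiteness of the regularizer excludes a token of positive probability that `πref` never emits
  have hzero : ∀ π' : Policy A, M.policyKL π' πref ≠ ∞ → 0 < M.occupancy π' s →
      πref s c = 0 → π' s c = 0 := by
    intro π' hfin' hpos h0
    by_contra h
    rw [policyKL_eq_tsum] at hfin'
    refine ENNReal.ne_top_of_tsum_ne_top hfin' (s, c) ?_
    simp only [h0, ENNReal.toReal_zero, mul_zero]
    exact klTerm_zero_right (mul_pos (ENNReal.toReal_pos h (PMF.apply_ne_top _ _)) hpos)
  have href : 0 < (πref s c).toReal := by
    refine ENNReal.toReal_pos (fun h0 => hc ?_) (PMF.apply_ne_top _ _)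
    rw [hzero π₁ h₁ hs₁ h0, hzero π₂ h₂ hs₂ h0]
  rw [policyKL_eq_tsum] at hfin
  simp_rw [policyKL_eq_tsum, ← ENNReal.tsum_mul_left, ← ENNReal.tsum_add]
  refine ENNReal.tsum_lt_tsum hfin (fun x => ?_) (i := (s, c)) ?_
  · rw [hsa, hocc, add_mul, mul_assoc, mul_assoc]
    exact klTerm_add_le _ _ _ _ ha.le hb.le
  · rw [hsa, hocc, add_mul, mul_assoc, mul_assoc]
    refine klTerm_add_lt (M.stateAction_nonneg _ _) (mul_pos hs₁ href) (M.stateAction_nonneg _ _)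
      (mul_pos hs₂ href) ha hb fun h => hc ?_
    simp only [stateAction] at h
    rw [mul_comm, mul_div_mul_left _ _ hs₁.ne', mul_comm, mul_div_mul_left _ _ hs₂.ne',
      div_left_inj' href.ne'] at h
    exact (ENNReal.toReal_eq_toReal_iff' (PMF.apply_ne_top _ _) (PMF.apply_ne_top _ _)).1 h

/-- Policies that agree wherever both have positive occupancy have the same occupancy measure. -/
lemma occupancy_eq_of_agree {π₁ π₂ : Policy A}
    (h : ∀ s, 0 < M.occupancy π₁ s → 0 < M.occupancy π₂ s → π₁ s = π₂ s) :
    M.occupancy π₁ = M.occupancy π₂ := by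
  classical
  funext s
  induction s using List.reverseRecOn with
  | nil =>
    refine mul_left_cancel₀ (M.flowCoeff_pos []).ne' ?_
    rw [flowCoeff_mul_occupancy, flowCoeff_mul_occupancy]
    simp [inflow]
  | append_singleton s a ih =>
    refine mul_left_cancel₀ (M.flowCoeff_pos (s ++ [a])).ne' ?_
    rw [flowCoeff_mul_occupancy, flowCoeff_mul_occupancy, inflow_concat, inflow_concat]
    simp only [stateAction]
    rcases (M.occupancy_nonneg π₁ s).eq_or_lt with h0 | h0
    · simp only [← ih, ← h0, mul_zero]
    · rw [h s h0 (ih ▸ h0), ih]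

lemma stateAction_eq_of_agree {π₁ π₂ : Policy A}
    (h : ∀ s, 0 < M.occupancy π₁ s → 0 < M.occupancy π₂ s → π₁ s = π₂ s) :
    M.stateAction π₁ = M.stateAction π₂ := by
  have ho := M.occupancy_eq_of_agree h
  funext x
  rw [stateAction, stateAction]
  rcases (M.occupancy_nonneg π₁ x.1).eq_or_lt with h0 | h0
  · rw [← ho, ← h0, mul_zero, mul_zero]
  · rw [h x.1 h0 (ho ▸ h0), ho]

end TokenMDP

/-! ### A minimax lemma -/

/-- If a family `g p` of payoff vectors is convex up to domination and each of them has a coordinate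
that is at least `c`, then one convex combination of the coordinates is at least `c` throughout: a
hyperplane separates the payoffs from the orthant of vectors below `c`. -/
lemma exists_weights_le_sum {P ι : Type*} [Nonempty P] [Fintype ι] (g : P → ι → ℝ) (c : ℝ)
    (hconv : ∀ p q (a b : ℝ), 0 ≤ a → 0 ≤ b → a + b = 1 →
      ∃ s, ∀ i, g s i ≤ a * g p i + b * g q i)
    (h : ∀ p, ∃ i, c ≤ g p i) :
    ∃ w : ι → ℝ, (∀ i, 0 ≤ w i) ∧ ∑ i, w i = 1 ∧ ∀ p, c ≤ ∑ i, w i * g p i := by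
  classical
  have hO : Convex ℝ (univ.pi fun _ : ι => Iio c) := convex_pi fun i _ => convex_Iio c
  have hO' : IsOpen (univ.pi fun _ : ι => Iio c) := isOpen_set_pi finite_univ fun i _ => isOpen_Iio
  have hT : Convex ℝ {z : ι → ℝ | ∃ p, ∀ i, g p i ≤ z i} := by
    rintro x ⟨p, hp⟩ y ⟨q, hq⟩ a b ha hb hab
    obtain ⟨s, hs⟩ := hconv p q a b ha hb hab
    refine ⟨s, fun i => (hs i).trans ?_⟩
    simp only [Pi.add_apply, Pi.smul_apply, smul_eq_mul]
    exact add_le_add (mul_le_mul_of_nonneg_left (hp i) ha) (mul_le_mul_of_nonneg_left (hq i) hb)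
  have hdisj : Disjoint (univ.pi fun _ : ι => Iio c) {z : ι → ℝ | ∃ p, ∀ i, g p i ≤ z i} := by
    refine disjoint_left.2 fun z hz => ?_
    rintro ⟨p, hp⟩
    obtain ⟨i, hi⟩ := h p
    exact absurd (hz i (mem_univ i)) (not_lt.2 (hi.trans (hp i)))
  obtain ⟨φ, u, h1, h2⟩ := geometric_hahn_banach_open hO hO' hT hdisj
  set w : ι → ℝ := fun i => φ (Pi.single i 1) with hw
  have hφ : ∀ z : ι → ℝ, φ z = ∑ i, w i * z i := by
    intro z
    conv_lhs => rw [← Finset.univ_sum_single z]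
    rw [map_sum]
    refine Finset.sum_congr rfl fun i _ => ?_
    have : Pi.single i (z i) = z i • (Pi.single i 1 : ι → ℝ) := by
      rw [← Pi.single_smul, smul_eq_mul, mul_one]
    rw [this, map_smul, smul_eq_mul, mul_comm]
  obtain ⟨p₀⟩ := ‹Nonempty P›
  have hw0 : ∀ i, 0 ≤ w i := by
    intro i
    by_contra! hi
    have h3 : u ≤ φ (g p₀) := h2 _ ⟨p₀, fun _ => le_rfl⟩
    have ht : 0 ≤ (φ (g p₀) - u + 1) / (-w i) := div_nonneg (by linarith) (by linarith)
    have h4 := h2 (g p₀ + ((φ (g p₀) - u + 1) / (-w i)) • Pi.single i 1) ⟨p₀, fun j => by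
      simp only [Pi.add_apply, Pi.smul_apply, smul_eq_mul]
      refine le_add_of_nonneg_right (mul_nonneg ht ?_)
      rw [Pi.single_apply]; split_ifs <;> norm_num⟩
    rw [map_add, map_smul, smul_eq_mul] at h4
    change u ≤ _ + _ * w i at h4
    rw [div_mul_eq_mul_div, div_neg, mul_div_cancel_right₀ _ hi.ne] at h4
    linarith
  have hW : 0 < ∑ i, w i := by
    refine lt_of_le_of_ne (Finset.sum_nonneg fun i _ => hw0 i) fun h0 => ?_
    have h3 : ∀ i, w i = 0 := fun i =>
      (Finset.sum_eq_zero_iff_of_nonneg fun i _ => hw0 i).1 h0.symm i (Finset.mem_univ i)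
    have h4 := (h1 (fun _ => c - 1) fun i _ => by simp).trans_le (h2 _ ⟨p₀, fun _ => le_rfl⟩)
    simp [hφ, h3] at h4
  have hu : c * ∑ i, w i ≤ u := by
    by_contra! hlt
    have h3 := h1 (fun _ => u / ∑ i, w i) fun i _ => (div_lt_iff₀ hW).2 hlt
    rw [hφ, ← Finset.sum_mul, mul_div_cancel₀ _ hW.ne'] at h3
    exact lt_irrefl _ h3
  refine ⟨fun i => w i / ∑ j, w j, fun i => div_nonneg (hw0 i) hW.le, ?_, fun p => ?_⟩
  · rw [← Finset.sum_div, div_self hW.ne']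
  · have h3 := hu.trans (h2 _ ⟨p, fun _ => le_rfl⟩)
    rw [hφ] at h3
    simp_rw [div_mul_eq_mul_div]
    rwa [← Finset.sum_div, le_div_iff₀ hW]

namespace TokenMDP

variable {A : Type*} (M : TokenMDP A) {β : ℝ} {πE πref : Policy A}

/-! ### The two objectives -/

/-- The regularization penalty `β D_KL(π ‖ π_ref)`. -/
noncomputable def penalty (β : ℝ) (πref π : Policy A) : ℝ≥0∞ :=
  ENNReal.ofReal β * M.policyKL π πref

lemma coe_penalty (hβ : 0 < β) (π : Policy A) :
    (β : EReal) * (M.policyKL π πref : EReal) = (M.penalty β πref π : EReal) := by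
  rw [penalty, EReal.coe_ennreal_mul, EReal.coe_ennreal_ofReal, max_eq_left hβ.le]

lemma penalty_ne_top {π : Policy A} (h : M.policyKL π πref ≠ ∞) : M.penalty β πref π ≠ ∞ :=
  ENNReal.mul_ne_top ENNReal.ofReal_ne_top h

lemma policyKL_ne_top (hβ : 0 < β) {π : Policy A} (h : M.penalty β πref π ≠ ∞) :
    M.policyKL π πref ≠ ∞ := by
  intro h'
  rw [penalty, h', ENNReal.mul_top (ENNReal.ofReal_pos.2 hβ).ne'] at h
  exact h rfl

lemma lowerSemicontinuous_penalty [Fintype A] (β : ℝ) (πref : Policy A) :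
    LowerSemicontinuous fun π : Policy A => M.penalty β πref π :=
  (ENNReal.continuous_const_mul ENNReal.ofReal_ne_top).comp_lowerSemicontinuous
    (M.lowerSemicontinuous_policyKL πref) fun _ _ h => mul_le_mul_right h _

lemma matchingObjective_eq (hf : IsDivergenceGenerator f) (hβ : 0 < β) (π : Policy A) :
    M.matchingObjective f β πE πref π
      = ((∑' x, excess f (M.stateAction π x) (M.stateAction πE x) + M.penalty β πref π : ℝ≥0∞) :
        EReal) := by
  rw [matchingObjective, coe_penalty M hβ, fDiv_eq_tsum_excess hf (M.stateAction_nonneg π)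
    (M.stateAction_nonneg πE) (M.hasSum_stateAction π) (M.hasSum_stateAction πE),
    EReal.coe_ennreal_add]

lemma regularizedReturn_eq (hβ : 0 < β) (r : List A × A → ℝ) (π : Policy A) :
    M.regularizedReturn β πref r π
      = ((∑' x, M.stateAction π x * r x : ℝ) : EReal) - (M.penalty β πref π : EReal) := by
  rw [regularizedReturn, coe_penalty M hβ]

lemma regularizedReturn_ref (r : List A × A → ℝ) :
    M.regularizedReturn β πref r πref = ((∑' x, M.stateAction πref x * r x : ℝ) : EReal) := by
  simp [regularizedReturn, policyKL_self]

lemma regularizedReturn_of_ne_top (hβ : 0 < β) (r : List A × A → ℝ) {π : Policy A}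
    (h : M.penalty β πref π ≠ ∞) :
    M.regularizedReturn β πref r π
      = ((∑' x, M.stateAction π x * r x - (M.penalty β πref π).toReal : ℝ) : EReal) := by
  rw [M.regularizedReturn_eq hβ, EReal.coe_sub, EReal.coe_ennreal_toReal h]

lemma regularizedReturn_of_eq_top (hβ : 0 < β) (r : List A × A → ℝ) {π : Policy A}
    (h : M.penalty β πref π = ∞) : M.regularizedReturn β πref r π = ⊥ := by
  rw [M.regularizedReturn_eq hβ, h, EReal.coe_ennreal_top, EReal.sub_top]

lemma summable_stateAction_mul {r : List A × A → ℝ} (hr : M.IntegrableReward r) (π : Policy A) :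
    Summable fun x => M.stateAction π x * r x := by
  refine Summable.of_abs ((hr π).congr fun x => ?_)
  rw [abs_mul, abs_of_nonneg (M.stateAction_nonneg π x)]

/-! ### Weak duality -/

lemma coe_mul_conjugate {r : List A × A → ℝ} (hr : AdmissibleReward f r) (π : Policy A)
    (x : List A × A) :
    (M.stateAction π x : EReal) * conjugate f (-(r x))
      = ((M.stateAction π x * conjReal f (-(r x)) : ℝ) : EReal) := by
  rw [EReal.coe_mul, coe_conjReal (hr x)]

/-- The expectation of `f*(-r)` exceeds that of `-r` by a sum of nonnegative terms. -/
lemma esum_conjugate_eq (hf : IsDivergenceGenerator f) {r : List A × A → ℝ}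
    (hr : AdmissibleReward f r) (hint : M.IntegrableReward r) (π : Policy A) :
    (esum fun x => (M.stateAction π x : EReal) * conjugate f (-(r x)))
      = ((∑' x, -(M.stateAction π x * r x) : ℝ) : EReal)
        + ((∑' x, ENNReal.ofReal (M.stateAction π x * (conjReal f (-(r x)) + r x)) : ℝ≥0∞) :
          EReal) := by
  rw [← esum_add (M.summable_stateAction_mul hint π).neg]
  congr 1
  funext x
  have h := mul_sub_le_conjReal (hr x) one_pos
  rw [hf.map_one] at h
  rw [coe_mul_conjugate M hr, EReal.coe_ennreal_ofReal, max_eq_left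
    (mul_nonneg (M.stateAction_nonneg π x) (by linarith)), ← EReal.coe_add]
  congr 1
  ring

lemma esum_conjugate_ne_bot (hf : IsDivergenceGenerator f) {r : List A × A → ℝ}
    (hr : AdmissibleReward f r) (hint : M.IntegrableReward r) (π : Policy A) :
    (esum fun x => (M.stateAction π x : EReal) * conjugate f (-(r x))) ≠ ⊥ := by
  rw [M.esum_conjugate_eq hf hr hint]
  exact ne_bot_of_le_ne_bot (EReal.coe_ne_bot _)
    (le_add_of_nonneg_right (EReal.coe_ennreal_nonneg _))

/-- Weak duality, for each policy separately: the Fenchel-Young inequality, summed. -/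
lemma neg_matchingObjective_le (hf : IsDivergenceGenerator f) (hβ : 0 < β)
    {r : List A × A → ℝ} (hr : AdmissibleReward f r) (hint : M.IntegrableReward r)
    (π : Policy A) :
    -(M.matchingObjective f β πE πref π)
      ≤ (esum fun x => (M.stateAction πE x : EReal) * conjugate f (-(r x)))
        + M.regularizedReturn β πref r π := by
  rw [M.matchingObjective_eq hf hβ, M.esum_conjugate_eq hf hr hint]
  set S := ∑' x, excess f (M.stateAction π x) (M.stateAction πE x) with hSdef
  set u : List A × A → ℝ := fun x => M.stateAction πE x * (conjReal f (-(r x)) + r x) with hu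
  rcases eq_or_ne (S + M.penalty β πref π) ∞ with htop | htop
  · rw [htop, EReal.coe_ennreal_top, EReal.neg_top]
    exact bot_le
  obtain ⟨hS, hpen⟩ := ENNReal.add_ne_top.1 htop
  rw [M.regularizedReturn_of_ne_top hβ r hpen]
  have hu0 : ∀ x, 0 ≤ u x := fun x => by
    have h := mul_sub_le_conjReal (hr x) one_pos
    rw [hf.map_one] at h
    exact mul_nonneg (M.stateAction_nonneg πE x) (by linarith)
  rcases eq_or_ne (∑' x, ENNReal.ofReal (u x)) ∞ with hU | hU
  · rw [hU, EReal.coe_ennreal_top, EReal.coe_add_top, EReal.top_add_coe]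
    exact le_top
  have hus : Summable u := (ENNReal.summable_toReal hU).congr fun x => ENNReal.toReal_ofReal (hu0 x)
  have hU' : (∑' x, ENNReal.ofReal (u x)) = ENNReal.ofReal (∑' x, u x) :=
    (ENNReal.ofReal_tsum_of_nonneg hu0 hus).symm
  -- the sum of the affine minorants with slopes `-r x`, relative to those with the base slope
  have hsum := ((((M.summable_stateAction_mul hint π).hasSum.neg).sub hus.hasSum).add
    (M.summable_stateAction_mul hint πE).hasSum).sub
    (((M.hasSum_stateAction π).sub (M.hasSum_stateAction πE)).mul_left (basePoint f))
  have hle : ∀ x, tilt f (M.stateAction π x) (M.stateAction πE x) (-(r x))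
      ≤ (excess f (M.stateAction π x) (M.stateAction πE x)).toReal := by
    intro x
    rw [← ENNReal.ofReal_le_iff_le_toReal (ENNReal.ne_top_of_tsum_ne_top hS x)]
    exact le_iSup (fun y : conjDomain f => ENNReal.ofReal
      (tilt f (M.stateAction π x) (M.stateAction πE x) y)) ⟨_, hr x⟩
  have hmain := hasSum_le hle (hsum.congr_fun fun x => by simp only [tilt, hu]; ring)
    (ENNReal.hasSum_toReal hS)
  rw [← ENNReal.tsum_toReal_eq (ENNReal.ne_top_of_tsum_ne_top hS), ← hSdef] at hmain
  rw [hU', EReal.coe_ennreal_ofReal, max_eq_left (tsum_nonneg hu0), ← EReal.coe_add,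
    ← EReal.coe_add, ← EReal.coe_ennreal_toReal htop, ← EReal.coe_neg, EReal.coe_le_coe_iff,
    ENNReal.toReal_add hS hpen, tsum_neg]
  linarith

lemma neg_matchingObjective_le_rewardObjective (hf : IsDivergenceGenerator f) (hβ : 0 < β)
    {r : List A × A → ℝ} (hr : AdmissibleReward f r) (hint : M.IntegrableReward r)
    (π : Policy A) :
    -(M.matchingObjective f β πE πref π) ≤ M.rewardObjective f β πE πref r :=
  (M.neg_matchingObjective_le hf hβ hr hint π).trans
    (add_le_add le_rfl (le_iSup (fun π => M.regularizedReturn β πref r π) π))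

lemma iSup_regularizedReturn_ne_bot (r : List A × A → ℝ) :
    ⨆ π : Policy A, M.regularizedReturn β πref r π ≠ ⊥ := by
  refine ne_bot_of_le_ne_bot ?_ (le_iSup (fun π => M.regularizedReturn β πref r π) πref)
  rw [regularizedReturn_ref]
  exact EReal.coe_ne_bot _

/-! ### Strong duality -/

lemma continuous_gain (hf : IsDivergenceGenerator f) {y : List A × A → ℝ}
    (hy : y ∈ dualSet f (List A × A)) :
    Continuous fun π : Policy A => gain f (M.stateAction π) (M.stateAction πE) y := by
  simp_rw [gain_eq_sum hf _ _ hy]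
  refine continuous_finsetSum _ fun x _ => ?_
  exact ((M.continuous_stateAction x).mul continuous_const).sub continuous_const

/-- Below the infimum of the matching objective, one dual variable works for all policies. -/
lemma exists_dual_forall_le [Fintype A] (hf : IsDivergenceGenerator f) (hβ : 0 < β) {c : ℝ}
    (hc : ∀ π, (c : EReal) < M.matchingObjective f β πE πref π) :
    ∃ y ∈ dualSet f (List A × A), ∀ π, M.penalty β πref π ≠ ∞ →
      c ≤ gain f (M.stateAction π) (M.stateAction πE) y + (M.penalty β πref π).toReal := by
  -- by compactness finitely many dual variables suffice
  have hopen : ∀ y : dualSet f (List A × A), IsOpen {π : Policy A | (c : EReal) <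
      (gain f (M.stateAction π) (M.stateAction πE) y : EReal) + (M.penalty β πref π : EReal)} := by
    intro y
    refine LowerSemicontinuous.isOpen_preimage ?_ (c : EReal)
    refine LowerSemicontinuous.add'
      (continuous_coe_real_ereal.comp (M.continuous_gain hf y.2)).lowerSemicontinuous
      (continuous_coe_ennreal_ereal.comp_lowerSemicontinuous
        (M.lowerSemicontinuous_penalty β πref) EReal.coe_ennreal_strictMono.monotone) fun π => ?_
    exact EReal.continuousAt_add (.inl (EReal.coe_ne_top _)) (.inl (EReal.coe_ne_bot _))
  obtain ⟨t, ht⟩ := isCompact_univ.elim_finite_subcover _ hopen fun π _ => by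
    have h := hc π
    rw [M.matchingObjective_eq hf hβ, EReal.coe_ennreal_add] at h
    obtain ⟨y, hy, h'⟩ := exists_lt_gain_add hf h
    exact mem_iUnion.2 ⟨⟨y, hy⟩, h'⟩
  -- a convex combination of these works for all policies at once
  have : Nonempty {π : Policy A // M.penalty β πref π ≠ ∞} :=
    ⟨⟨πref, M.penalty_ne_top (by rw [policyKL_self]; exact ENNReal.zero_ne_top)⟩⟩
  let g : {π : Policy A // M.penalty β πref π ≠ ∞} → t → ℝ := fun π y =>
    gain f (M.stateAction π) (M.stateAction πE) y + (M.penalty β πref π).toReal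
  have hconv : ∀ p q (a b : ℝ), 0 ≤ a → 0 ≤ b → a + b = 1 →
      ∃ s, ∀ i, g s i ≤ a * g p i + b * g q i := by
    rintro ⟨π₁, h₁⟩ ⟨π₂, h₂⟩ a b ha hb hab
    obtain ⟨π, hocc, hsa⟩ := M.exists_mix π₁ π₂ ha hb hab
    have hle : M.penalty β πref π ≤ ENNReal.ofReal a * M.penalty β πref π₁
        + ENNReal.ofReal b * M.penalty β πref π₂ := by
      unfold penalty
      calc _ ≤ ENNReal.ofReal β * (ENNReal.ofReal a * M.policyKL π₁ πref
            + ENNReal.ofReal b * M.policyKL π₂ πref) :=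
            mul_le_mul_right (policyKL_mix_le ha hb hocc hsa) _
        _ = _ := by ring
    have hfin : ENNReal.ofReal a * M.penalty β πref π₁
        + ENNReal.ofReal b * M.penalty β πref π₂ ≠ ∞ := by finiteness
    refine ⟨⟨π, ne_top_of_le_ne_top hfin hle⟩, fun y => ?_⟩
    have hle' := ENNReal.toReal_mono hfin hle
    rw [ENNReal.toReal_add (by finiteness) (by finiteness), ENNReal.toReal_mul, ENNReal.toReal_mul,
      ENNReal.toReal_ofReal ha, ENNReal.toReal_ofReal hb] at hle'
    have hg := gain_linear hf (M.stateAction π₁) (M.stateAction π₂) (M.stateAction πE) y.1.2 hab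
    rw [← (funext hsa : M.stateAction π = _)] at hg
    simp only [g]
    linarith
  have hcover : ∀ p, ∃ y, c ≤ g p y := by
    rintro ⟨π, hπ⟩
    have := ht (mem_univ π)
    simp only [mem_iUnion, exists_prop] at this
    obtain ⟨y, hy, h⟩ := this
    refine ⟨⟨y, hy⟩, ?_⟩
    rw [mem_ofPred_eq, ← EReal.coe_ennreal_toReal hπ, ← EReal.coe_add,
      EReal.coe_lt_coe_iff] at h
    exact h.le
  obtain ⟨w, hw0, hw1, hw⟩ := exists_weights_le_sum g c hconv hcover
  obtain ⟨z, hz, h⟩ := exists_sum_gain_le hf (M.stateAction_nonneg πE)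
    (y := fun y : t => (y : List A × A → ℝ)) (fun y => y.1.2) hw0 hw1
  refine ⟨z, hz, fun π hπ => (hw ⟨π, hπ⟩).trans ?_⟩
  simp only [g, mul_add, Finset.sum_add_distrib]
  rw [← Finset.sum_mul, hw1, one_mul]
  exact add_le_add (h _) le_rfl

lemma boundedReward_neg_of_mem_dualSet {y : List A × A → ℝ} (hy : y ∈ dualSet f (List A × A)) :
    BoundedReward fun x => -(y x) := by
  have hfin : (range y).Finite := by
    refine ((hy.2.image y).union (finite_singleton (basePoint f))).subset ?_
    rintro _ ⟨x, rfl⟩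
    by_cases h : y x = basePoint f
    · exact Or.inr h
    · exact Or.inl ⟨x, h, rfl⟩
  obtain ⟨C, hC⟩ := (hfin.image fun z => |z|).bddAbove
  exact ⟨C, fun x => by
    rw [abs_neg]; exact hC ⟨_, mem_range_self x, rfl⟩⟩

/-- Strong duality: any level below the matching objective is certified by a bounded reward. -/
lemma exists_rewardObjective_le [Fintype A] (hf : IsDivergenceGenerator f) (hβ : 0 < β) {c : ℝ}
    (hc : ∀ π, (c : EReal) < M.matchingObjective f β πE πref π) :
    ∃ r, AdmissibleReward f r ∧ BoundedReward r ∧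
      M.rewardObjective f β πE πref r ≤ ((-c : ℝ) : EReal) := by
  obtain ⟨y, hy, h⟩ := M.exists_dual_forall_le hf hβ hc
  have hadm : AdmissibleReward f fun x => -(y x) := fun x => by
    rw [neg_neg]; exact hy.1 x
  refine ⟨fun x => -(y x), hadm, boundedReward_neg_of_mem_dualSet hy, ?_⟩
  have hE : (esum fun x => (M.stateAction πE x : EReal) * conjugate f (-(-(y x))))
      = ((∑' x, M.stateAction πE x * conjReal f (y x) : ℝ) : EReal) := by
    rw [← esum_coe (hasSum_mul_of_finite (M.hasSum_stateAction πE)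
      (finite_conjReal_ne hf hy)).summable]
    congr 1
    funext x
    rw [coe_mul_conjugate M hadm, neg_neg]
  rw [rewardObjective, hE]
  have hJ : ⨆ π : Policy A, M.regularizedReturn β πref (fun x => -(y x)) π
      ≤ ((-c - ∑' x, M.stateAction πE x * conjReal f (y x) : ℝ) : EReal) := by
    refine iSup_le fun π => ?_
    rcases eq_or_ne (M.penalty β πref π) ∞ with hπ | hπ
    · rw [M.regularizedReturn_of_eq_top hβ _ hπ]
      exact bot_le
    · rw [M.regularizedReturn_of_ne_top hβ _ hπ, EReal.coe_le_coe_iff]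
      have h1 := h π hπ
      rw [gain_eq_sub hf (M.hasSum_stateAction π) (M.hasSum_stateAction πE) hy] at h1
      simp only [mul_neg, tsum_neg]
      linarith
  refine (add_le_add le_rfl hJ).trans (le_of_eq ?_)
  rw [← EReal.coe_add]
  congr 1
  ring

/-! ### Attainment -/

lemma exists_forall_le_of_lowerSemicontinuous [Fintype A] {g : Policy A → ℝ≥0∞}
    (hg : LowerSemicontinuous g) (π₀ : Policy A) : ∃ π, ∀ π', g π ≤ g π' := by
  obtain ⟨π, -, h⟩ := (hg.lowerSemicontinuousOn univ).exists_isMinOn ⟨π₀, mem_univ _⟩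
    isCompact_univ
  exact ⟨π, fun π' => h (mem_univ π')⟩

lemma exists_forall_matchingObjective_le [Fintype A] (hf : IsDivergenceGenerator f) (hβ : 0 < β) :
    ∃ π, ∀ π', M.matchingObjective f β πE πref π ≤ M.matchingObjective f β πE πref π' := by
  have hlsc : LowerSemicontinuous fun π : Policy A =>
      ∑' x, excess f (M.stateAction π x) (M.stateAction πE x) + M.penalty β πref π := by
    refine (lowerSemicontinuous_tsum fun x => lowerSemicontinuous_iSup fun y => ?_).add
      (M.lowerSemicontinuous_penalty β πref)
    refine (ENNReal.continuous_ofReal.comp ?_).lowerSemicontinuous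
    exact ((M.continuous_stateAction x).mul continuous_const).sub continuous_const
  obtain ⟨π, h⟩ := exists_forall_le_of_lowerSemicontinuous hlsc πref
  refine ⟨π, fun π' => ?_⟩
  rw [M.matchingObjective_eq hf hβ, M.matchingObjective_eq hf hβ]
  exact EReal.coe_ennreal_le_coe_ennreal_iff.2 (h π')

lemma exists_forall_regularizedReturn_le [Fintype A] (hβ : 0 < β) {r : List A × A → ℝ}
    (hr : BoundedReward r) :
    ∃ π, ∀ π', M.regularizedReturn β πref r π' ≤ M.regularizedReturn β πref r π := by
  obtain ⟨C, hC⟩ := hr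
  -- `C - J(π)` is a sum of nonnegative lower semicontinuous terms
  have hlsc : LowerSemicontinuous fun π : Policy A =>
      ∑' x, ENNReal.ofReal (M.stateAction π x * (C - r x)) + M.penalty β πref π := by
    refine (lowerSemicontinuous_tsum fun x => ?_).add (M.lowerSemicontinuous_penalty β πref)
    refine (ENNReal.continuous_ofReal.comp ?_).lowerSemicontinuous
    exact (M.continuous_stateAction x).mul continuous_const
  have hJ : ∀ π, M.regularizedReturn β πref r π = (C : EReal) -
      ((∑' x, ENNReal.ofReal (M.stateAction π x * (C - r x)) + M.penalty β πref π : ℝ≥0∞) :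
        EReal) := by
    intro π
    have h0 : ∀ x, 0 ≤ M.stateAction π x * (C - r x) := fun x =>
      mul_nonneg (M.stateAction_nonneg π x) (by linarith [(abs_le.1 (hC x)).2])
    have hs : Summable fun x => M.stateAction π x * r x := by
      refine Summable.of_norm_bounded ((M.hasSum_stateAction π).summable.mul_right C) fun x => ?_
      rw [Real.norm_eq_abs, abs_mul, abs_of_nonneg (M.stateAction_nonneg π x)]
      exact mul_le_mul_of_nonneg_left (hC x) (M.stateAction_nonneg π x)
    have hs2 := ((M.hasSum_stateAction π).mul_right C).sub hs.hasSum
    have hs3 : HasSum (fun x => M.stateAction π x * (C - r x))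
        (1 * C - ∑' x, M.stateAction π x * r x) := hs2.congr_fun fun x => mul_sub _ _ _
    have e : ∑' x, M.stateAction π x * r x = C - ∑' x, M.stateAction π x * (C - r x) := by
      rw [hs3.tsum_eq]; ring
    rw [M.regularizedReturn_eq hβ, ← ENNReal.ofReal_tsum_of_nonneg h0 hs3.summable, e,
      EReal.coe_ennreal_add, EReal.coe_ennreal_ofReal, max_eq_left (tsum_nonneg h0), EReal.coe_sub,
      sub_eq_add_neg, sub_eq_add_neg, sub_eq_add_neg, EReal.neg_add (.inl (EReal.coe_ne_bot _))
        (.inl (EReal.coe_ne_top _)), sub_eq_add_neg, add_assoc]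
  obtain ⟨π, h⟩ := exists_forall_le_of_lowerSemicontinuous hlsc πref
  refine ⟨π, fun π' => ?_⟩
  rw [hJ, hJ]
  exact EReal.sub_le_sub le_rfl (EReal.coe_ennreal_le_coe_ennreal_iff.2 (h π'))

/-! ### Optimal policies -/

/-- By strict convexity of the regularizer all maximizers of the regularized return have the same
state-action distribution, so that they share the value of every objective that depends on it. -/
lemma matchingObjective_eq_of_maximizers [Fintype A] (hβ : 0 < β) {r : List A × A → ℝ}
    (hint : M.IntegrableReward r) {π₁ π₂ : Policy A}
    (h₁ : ∀ π', M.regularizedReturn β πref r π' ≤ M.regularizedReturn β πref r π₁)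
    (h₂ : ∀ π', M.regularizedReturn β πref r π' ≤ M.regularizedReturn β πref r π₂) :
    M.matchingObjective f β πE πref π₁ = M.matchingObjective f β πE πref π₂ := by
  have hfin : ∀ π, (∀ π', M.regularizedReturn β πref r π' ≤ M.regularizedReturn β πref r π) →
      M.penalty β πref π ≠ ∞ := by
    intro π h htop
    have := h πref
    rw [M.regularizedReturn_of_eq_top hβ r htop, regularizedReturn_ref] at this
    exact EReal.coe_ne_bot _ (le_bot_iff.1 this)
  have hf₁ := hfin π₁ h₁
  have hf₂ := hfin π₂ h₂
  -- otherwise the equal mixture of the two policies has a larger return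
  have hagree : ∀ s, 0 < M.occupancy π₁ s → 0 < M.occupancy π₂ s → π₁ s = π₂ s := by
    intro s hs₁ hs₂
    by_contra hne
    obtain ⟨π, hocc, hsa⟩ := M.exists_mix π₁ π₂ (a := 1 / 2) (b := 1 / 2) (by norm_num)
      (by norm_num) (by norm_num)
    have hK₁ := M.policyKL_ne_top hβ hf₁
    have hK₂ := M.policyKL_ne_top hβ hf₂
    have hlt := policyKL_mix_lt (by norm_num) (by norm_num) hocc hsa hK₁ hK₂ hs₁ hs₂ hne
    have hK : M.policyKL π πref ≠ ∞ := hlt.ne_top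
    have hlt' := (ENNReal.toReal_lt_toReal hK (by finiteness)).2 hlt
    rw [ENNReal.toReal_add (by finiteness) (by finiteness), ENNReal.toReal_mul,
      ENNReal.toReal_mul, ENNReal.toReal_ofReal (by norm_num)] at hlt'
    have hE : ∑' x, M.stateAction π x * r x = 1 / 2 * ∑' x, M.stateAction π₁ x * r x
        + 1 / 2 * ∑' x, M.stateAction π₂ x * r x := by
      rw [← tsum_mul_left, ← tsum_mul_left, ← Summable.tsum_add
        ((M.summable_stateAction_mul hint π₁).mul_left _)
        ((M.summable_stateAction_mul hint π₂).mul_left _)]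
      refine tsum_congr fun x => ?_
      rw [hsa]; ring
    have g₁ := h₁ π
    have g₂ := h₂ π
    rw [M.regularizedReturn_of_ne_top hβ r (M.penalty_ne_top hK),
      M.regularizedReturn_of_ne_top hβ r hf₁, EReal.coe_le_coe_iff] at g₁
    rw [M.regularizedReturn_of_ne_top hβ r (M.penalty_ne_top hK),
      M.regularizedReturn_of_ne_top hβ r hf₂, EReal.coe_le_coe_iff] at g₂
    simp only [penalty, ENNReal.toReal_mul, ENNReal.toReal_ofReal hβ.le] at g₁ g₂
    have := mul_lt_mul_of_pos_left hlt' hβ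
    linarith
  have hsa := M.stateAction_eq_of_agree hagree
  rw [matchingObjective, matchingObjective, policyKL_eq_tsum, policyKL_eq_tsum, hsa,
    M.occupancy_eq_of_agree hagree]

/-- If a reward closes the duality gap at a policy, then this policy is optimal for the reward. -/
lemma regularizedReturn_le_of_rewardObjective_le (hf : IsDivergenceGenerator f) (hβ : 0 < β)
    {r : List A × A → ℝ} (hr : AdmissibleReward f r) (hint : M.IntegrableReward r)
    {π : Policy A}
    (h : M.rewardObjective f β πE πref r ≤ -(M.matchingObjective f β πE πref π)) (π' : Policy A) :
    M.regularizedReturn β πref r π' ≤ M.regularizedReturn β πref r π := by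
  refine (le_iSup (fun π => M.regularizedReturn β πref r π) π').trans ?_
  have h1 := h.trans (M.neg_matchingObjective_le hf hβ hr hint π)
  have hbot := M.esum_conjugate_ne_bot hf hr hint πE
  have hpos : M.rewardObjective f β πE πref r ≠ ⊤ := by
    refine ne_top_of_le_ne_top (b := 0) EReal.zero_ne_top (h.trans ?_)
    rw [M.matchingObjective_eq hf hβ, EReal.neg_le, neg_zero]
    exact EReal.coe_ennreal_nonneg _
  have htop : (esum fun x => (M.stateAction πE x : EReal) * conjugate f (-(r x))) ≠ ⊤ := by
    intro htop
    refine hpos ?_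
    rw [rewardObjective, htop, EReal.top_add_of_ne_bot (M.iSup_regularizedReturn_ne_bot r)]
  rw [rewardObjective] at h1
  generalize (esum fun x => (M.stateAction πE x : EReal) * conjugate f (-(r x))) = e at *
  lift e to ℝ using ⟨htop, hbot⟩
  have h2 := add_le_add (le_refl ((-e : ℝ) : EReal)) h1
  rwa [← add_assoc, ← add_assoc, ← EReal.coe_add, neg_add_cancel, EReal.coe_zero, zero_add,
    zero_add] at h2

end TokenMDP

end TokenLevel

theorem mainTheorem1 {A : Type*} [Fintype A] (M : TokenLevel.TokenMDP A)
    (f : ℝ → ℝ) (hf : TokenLevel.IsDivergenceGenerator f) (β : ℝ) (hβ : 0 < β)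
    (πE πref : TokenLevel.Policy A)
    (R : Set (List A × A → ℝ))
    (hR_adm : ∀ r ∈ R, TokenLevel.AdmissibleReward f r ∧ M.IntegrableReward r)
    (hR_bdd : ∀ r, TokenLevel.AdmissibleReward f r → TokenLevel.BoundedReward r → r ∈ R) :
    (⨅ π : TokenLevel.Policy A, M.matchingObjective f β πE πref π)
        = -(⨅ r ∈ R, M.rewardObjective f β πE πref r)
    ∧ (∃ π : TokenLevel.Policy A, ∀ π' : TokenLevel.Policy A,
        M.matchingObjective f β πE πref π ≤ M.matchingObjective f β πE πref π')
    ∧ (∀ r : List A × A → ℝ, TokenLevel.BoundedReward r →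
        ∃ π : TokenLevel.Policy A, ∀ π' : TokenLevel.Policy A,
          M.regularizedReturn β πref r π' ≤ M.regularizedReturn β πref r π)
    ∧ (∀ r ∈ R, (∀ r' ∈ R, M.rewardObjective f β πE πref r ≤ M.rewardObjective f β πE πref r') →
        ∀ π : TokenLevel.Policy A,
          (∀ π' : TokenLevel.Policy A,
            M.matchingObjective f β πE πref π ≤ M.matchingObjective f β πE πref π') ↔
          (∀ π' : TokenLevel.Policy A,
            M.regularizedReturn β πref r π' ≤ M.regularizedReturn β πref r π)) := by
  have hdual : (⨅ π : TokenLevel.Policy A, M.matchingObjective f β πE πref π)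
      = -(⨅ r ∈ R, M.rewardObjective f β πE πref r) := by
    apply le_antisymm
    · refine EReal.ge_of_forall_gt_iff_ge.1 fun c hc => ?_
      obtain ⟨r, hr, hb, hle⟩ := M.exists_rewardObjective_le hf hβ (πE := πE) (πref := πref)
        fun π => hc.trans_le (iInf_le _ π)
      rw [EReal.le_neg, ← EReal.coe_neg]
      exact (iInf₂_le r (hR_bdd r hr hb)).trans hle
    · refine le_iInf fun π => ?_
      rw [EReal.neg_le]
      exact le_iInf₂ fun r hr =>
        M.neg_matchingObjective_le_rewardObjective hf hβ (hR_adm r hr).1 (hR_adm r hr).2 π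
  refine ⟨hdual, M.exists_forall_matchingObjective_le hf hβ,
    fun r hr => M.exists_forall_regularizedReturn_le hβ hr, fun r hr hmin π => ?_⟩
  obtain ⟨hadm, hint⟩ := hR_adm r hr
  have hopt : ∀ π, (∀ π', M.matchingObjective f β πE πref π ≤ M.matchingObjective f β πE πref π') →
      ∀ π', M.regularizedReturn β πref r π' ≤ M.regularizedReturn β πref r π := by
    intro π hπ
    refine M.regularizedReturn_le_of_rewardObjective_le hf hβ hadm hint (πE := πE) ?_
    rw [EReal.le_neg]
    refine (le_iInf hπ).trans (hdual.le.trans ?_)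
    rw [EReal.neg_le_neg_iff]
    exact le_iInf₂ hmin
  refine ⟨hopt π, fun hπ π' => ?_⟩
  obtain ⟨π₀, hπ₀⟩ := M.exists_forall_matchingObjective_le hf hβ (πE := πE) (πref := πref)
  rw [M.matchingObjective_eq_of_maximizers hβ hint hπ (hopt π₀ hπ₀)]
  exact hπ₀ π'
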